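/- **Setting.** Let $n\ge 0$, let $(e_i)_{1\le i\le n}$ be the standard basis of $\mathbb C^n$ with $(e_i,e_j)=\delta_{ij}$, and let $\alpha_i=e_i-e_{i+1}$, $\Gamma=\{\alpha_1,\dots,\alpha_{n-1}\}$. A Belavin–Drinfeld triple $(\Gamma_1,\Gamma_2,\tau)$ consists of subsets $\Gamma_1,\Gamma_2\subset\Gamma$ and a bijection $\tau:\Gamma_1\to\Gamma_2$ preserving $(\,,)$ and such that for every $\alpha\in\Gamma_1$ some $\tau^k\alpha\notin\Gamma_1$. Positive roots are the $e_i-e_j$, $i<j$. For $\alpha=e_i-e_j$ put $e_\alpha=e_{ij}$ (matrix unit) and $|\alpha|=|j-i|$. Extend $\tau$ additively to the positive roots in the span of $\Gamma_1$, and write $\alpha\prec\beta$ if $\tau^k\alpha=\beta$ for some $k\ge1$. For $\alpha=e_i-e_j$ with $|\alpha|>1$ and $\tau^k\alpha=\beta=e_p-e_l$, $k\ge 1$, write $\alpha\prec^{\leftarrow}\beta$ if $\tau^k\alpha_i=\alpha_{l-1}$; then $\mathrm{sign}(\alpha,\beta)=(-1)^{1-|\alpha|}$, and $\mathrm{sign}(\alpha,\beta)=1$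 for all other $\alpha\prec\beta$. For positive roots write $e_i-e_j\lessdot e_k-e_l$ iff $j=k$, and $\alpha\gtrdot\beta$ iff $\beta\lessdot\alpha$. $[S]$ is $1$ if $S$ is true and $0$ otherwise. Let $r^0=\sum_{i,j} s_{ij}\,e_{ii}\otimes e_{jj}$ with $s_{ij}=-s_{ji}\in\mathbb C$ satisfy $[(\alpha-\tau\alpha)\otimes1]r^0=\tfrac12[(\alpha+\tau\alpha)\otimes1]\sum_i e_{ii}\otimes e_{ii}$ for all $\alpha\in\Gamma_1$ (where $\sum_i\lambda_ie_i$ acts on diagonal matrices by $\sum_i a_ie_{ii}\mapsto\sum_i\lambda_ia_i$). Put, with $x\wedge y=x\otimes y-y\otimes x$, $$a=\sum_{\alpha\prec\beta}\mathrm{sign}(\alpha,\beta)\,e_{-\alpha}\wedge e_\beta,\quad r_s=\tfrac12\sum_ie_{ii}\otimes e_{ii}+\sum_{\alpha>0}e_{-\alpha}\otimes e_\alpha,\quad r=r^0+a+r_s,\quad \epsilon=ar_s+r_sa+a^2.$$ For $\hbar\in\mathbb C$ let $q=e^\hbar$, $q^y=e^{\hbar y}$, and $$R_s=q\sum_ie_{ii}\otimes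 e_{ii}+\sum_{i\ne j}e_{ii}\otimes e_{jj}+(q-q^{-1})\sum_{i>j}e_{ij}\otimes e_{ji}.$$ Writing $z=\sum z_{ik}^{jl}e_{ij}\otimes e_{kl}$, put $\tilde a=\sum a_{ik}^{jl}q^{a_{ik}^{jl}\epsilon_{ik}^{jl}}e_{ij}\otimes e_{kl}$ and $$R_{\mathrm{GGS}}=q^{r^0}\bigl(R_s+(q-q^{-1})\tilde a\bigr)q^{r^0}.$$ Finally put $$K_{\alpha,\beta}=\tfrac12[\alpha\lessdot\beta,\alpha\prec\beta]-\tfrac12[\alpha\gtrdot\beta,\alpha\prec\beta]+[\exists\gamma:\alpha\prec\gamma\prec\beta,\alpha\lessdot\gamma]-[\exists\gamma:\alpha\prec\gamma\prec\beta,\alpha\gtrdot\gamma]+[\alpha\prec^{\leftarrow}\beta](1-|\alpha|),$$ $$J^m=1+(q-q^{-1})\sum_{\tau^m\alpha=\beta}\mathrm{sign}(\alpha,\beta)\,q^{K_{\alpha,\beta}}e_\beta\otimes e_{-\alpha},\qquad J=J^1J^2J^3\cdots$$ (a finite product, since $J^m=1$ for large $m$), and $R_J=q^{r^0}J^{-1}R_sJ_{21}q^{r^0}$,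 where $J_{21}$ is $J$ with its tensor factors interchanged. **Theorem.** Let $(\Gamma_1,\Gamma_2,\tau)$ be the Cremmer–Gervais triple $\Gamma_1=\{\alpha_1,\dots,\alpha_{n-2}\}$, $\Gamma_2=\{\alpha_2,\dots,\alpha_{n-1}\}$, $\tau\alpha_i=\alpha_{i+1}$, or its inverse $(\Gamma_2,\Gamma_1,\tau^{-1})$, and let $r^0$ be any element as above. Then: 1. $R_{\mathrm{GGS}}$, as a function of $\hbar$, is the unique matrix all of whose entries have the form $x\,q^y(q-q^{-1})^z$ with $x,y\in\mathbb C$, $z\in\{0,1\}$, and which satisfies $R_{\mathrm{GGS}}\equiv1+2\hbar r+2\hbar^2r^2\pmod{\hbar^3}$; 2. $R_J=R_{\mathrm{GGS}}$ for every $\hbar\in\mathbb C$; 3. $R_J$ satisfies the quantum Yang–Baxter equation $R_{12}R_{13}R_{23}=R_{23}R_{13}R_{12}$ for every $\hbar\in\mathbb C$. -/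

import Mathlib

open scoped Kronecker
open Matrix Asymptotics

noncomputable section

namespace GGS

/-- `Mat_n(ℂ) ⊗ Mat_n(ℂ)`: the coefficient of `e_{ij} ⊗ e_{kl}` is the entry at row `(i, k)` and
column `(j, l)`. -/
abbrev Mat2 (n : ℕ) := Matrix (Fin n × Fin n) (Fin n × Fin n) ℂ

/-- The vector `e_i - e_j` of `ℂⁿ`, for the pair `p = (i, j)`. -/
def rootVec {n : ℕ} (p : Fin n × Fin n) : Fin n → ℂ :=
  Pi.single p.1 1 - Pi.single p.2 1

/-- The pair `(k, k + 1)`, standing for the simple root `α_k = e_k - e_{k+1}` (indices from `0`). -/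
def simplePair {n : ℕ} (k : Fin (n - 1)) : Fin n × Fin n :=
  (⟨k.val, by omega⟩, ⟨k.val + 1, by omega⟩)

/-- The simple root `α_k = e_k - e_{k+1}`. -/
def simpleRoot {n : ℕ} (k : Fin (n - 1)) : Fin n → ℂ := rootVec (simplePair k)

/-- A Belavin-Drinfeld triple of type `A_{n-1}`; the simple root `α_k` is represented by `k`. -/
structure BDTriple (n : ℕ) where
  Γ₁ : Finset (Fin (n - 1))
  Γ₂ : Finset (Fin (n - 1))
  τ : Γ₁ ≃ Γ₂
  isometry : ∀ a b : Γ₁,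
    simpleRoot (τ a).1 ⬝ᵥ simpleRoot (τ b).1 = simpleRoot a.1 ⬝ᵥ simpleRoot b.1
  /-- Iterating `τ` from any element of `Γ₁` eventually leads out of `Γ₁`. -/
  nilpotent : ∀ a ∈ Γ₁, ∃ b, b ∉ Γ₁ ∧
    Relation.TransGen (fun x y => ∃ h : x ∈ Γ₁, (τ ⟨x, h⟩).1 = y) a b

namespace BDTriple

variable {n : ℕ}

theorem nilpotent_inverse (T : BDTriple n) : ∀ a ∈ T.Γ₂, ∃ b, b ∉ T.Γ₂ ∧
    Relation.TransGen (fun x y => ∃ h : x ∈ T.Γ₂, (T.τ.symm ⟨x, h⟩).1 = y) a b := by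
  set r : Fin (n - 1) → Fin (n - 1) → Prop :=
    fun x y => ∃ h : x ∈ T.Γ₁, (T.τ ⟨x, h⟩).1 = y with hr
  have hfun : ∀ x y, Relation.TransGen r x x → r x y → Relation.TransGen r y y := by
    intro x y hx hxy
    obtain ⟨z, hz, hzx⟩ := Relation.TransGen.head'_iff.1 hx
    have : z = y := by
      obtain ⟨h1, e1⟩ := hz
      obtain ⟨h2, e2⟩ := hxy
      rw [← e1, ← e2]
    subst this
    exact Relation.TransGen.tail' hzx hxy
  have hchain : ∀ x y, Relation.TransGen r x y → Relation.TransGen r x x →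
      Relation.TransGen r y y := by
    intro x y hxy hx
    induction hxy with
    | single h => exact hfun _ _ hx h
    | tail _ h ih => exact hfun _ _ ih h
  have hmem : ∀ x, Relation.TransGen r x x → x ∈ T.Γ₁ := by
    intro x hx
    obtain ⟨z, ⟨h, _⟩, _⟩ := Relation.TransGen.head'_iff.1 hx
    exact h
  have hirr : ∀ x, ¬ Relation.TransGen r x x := by
    intro x hx
    obtain ⟨b, hb, hxb⟩ := T.nilpotent x (hmem x hx)
    exact hb (hmem b (hchain x b hxb hx))
  have : Std.Irrefl (Relation.TransGen r) := ⟨hirr⟩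
  have hwf : WellFounded (Relation.TransGen r) :=
    Finite.wellFounded_of_trans_of_irrefl _
  intro a
  induction a using hwf.induction with
  | _ a ih =>
    intro ha
    have hstep : r (T.τ.symm ⟨a, ha⟩).1 a := ⟨(T.τ.symm ⟨a, ha⟩).2, by simp⟩
    by_cases hc : (T.τ.symm ⟨a, ha⟩).1 ∈ T.Γ₂
    · obtain ⟨b, hb, hab⟩ := ih _ (Relation.TransGen.single hstep) hc
      exact ⟨b, hb, Relation.TransGen.head ⟨ha, rfl⟩ hab⟩
    · exact ⟨_, hc, Relation.TransGen.single ⟨ha, rfl⟩⟩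

/-- The triple `(Γ₂, Γ₁, τ⁻¹)`. -/
def inverse (T : BDTriple n) : BDTriple n where
  Γ₁ := T.Γ₂
  Γ₂ := T.Γ₁
  τ := T.τ.symm
  isometry a b := by
    have h := T.isometry (T.τ.symm a) (T.τ.symm b)
    simp only [Equiv.apply_symm_apply] at h
    exact h.symm
  nilpotent := T.nilpotent_inverse

/-- The Cremmer-Gervais triple. With roots numbered `α_1, …, α_{n-1}` (so that `α_{k+1}` is
represented by `k`): `Γ₁ = {α_1, …, α_{n-2}}`, `Γ₂ = {α_2, …, α_{n-1}}`, `τ α_i = α_{i+1}`. -/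
def cremmerGervais (n : ℕ) : BDTriple n where
  Γ₁ := Finset.univ.filter fun k => k.val + 1 < n - 1
  Γ₂ := Finset.univ.filter fun k => 0 < k.val
  τ :=
    { toFun := fun k => ⟨⟨k.1.val + 1, (Finset.mem_filter.1 k.2).2⟩, by simp⟩
      invFun := fun k => ⟨⟨k.1.val - 1, by omega⟩, by
        have := (Finset.mem_filter.1 k.2).2
        have := k.1.isLt
        simp only [Finset.mem_filter, Finset.mem_univ, true_and]
        omega⟩
      left_inv := fun k => by ext; simp
      right_inv := fun k => by
        have := (Finset.mem_filter.1 k.2).2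
        ext
        simp only
        omega }
  isometry a b := by
    simp only [simpleRoot, rootVec, simplePair, Equiv.coe_fn_mk, sub_dotProduct,
      single_dotProduct, Pi.sub_apply, Pi.single_apply, Fin.mk.injEq]
    simp
  nilpotent := by
    have key : ∀ (m : ℕ) (a : Fin (n - 1)), a.val + 1 < n - 1 → n - a.val = m →
        ∃ b, b ∉ (Finset.univ.filter fun k : Fin (n - 1) => k.val + 1 < n - 1) ∧
        Relation.TransGen (fun x y : Fin (n - 1) =>
          ∃ _ : x ∈ Finset.univ.filter fun k : Fin (n - 1) => k.val + 1 < n - 1,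
            x.val + 1 = y.val) a b := by
      intro m
      induction m with
      | zero => intro a ha h; omega
      | succ m ih =>
        intro a ha h
        by_cases hb : a.val + 1 + 1 < n - 1
        · obtain ⟨b, hb1, hb2⟩ := ih ⟨a.val + 1, ha⟩ hb (by simp only; omega)
          exact ⟨b, hb1, Relation.TransGen.head ⟨by simpa using ha, rfl⟩ hb2⟩
        · exact ⟨⟨a.val + 1, ha⟩, by simpa using hb,
            Relation.TransGen.single ⟨by simpa using ha, rfl⟩⟩
    intro a ha
    obtain ⟨b, hb, hab⟩ := key _ a (Finset.mem_filter.1 ha).2 rfl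
    exact ⟨b, hb, Relation.TransGen.mono (fun x y ⟨h, e⟩ => ⟨h, Fin.ext e⟩) _ _ hab⟩

end BDTriple

/-! Positive roots `e_i - e_j` are represented by pairs `(i, j)` with `i < j`. -/

/-- `|α|` -/
def rootLen {n : ℕ} (α : Fin n × Fin n) : ℤ := (α.2.val : ℤ) - α.1.val

/-- `e_α = e_{ij}` for `α = e_i - e_j`. -/
def eMat {n : ℕ} (α : Fin n × Fin n) : Matrix (Fin n) (Fin n) ℂ := Matrix.single α.1 α.2 1

/-- `e_i - e_j ⋖ e_k - e_l` iff `j = k`; `α ⋗ β` means `β ⋖ α`. -/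
def Lessdot {n : ℕ} (α β : Fin n × Fin n) : Prop := α.2 = β.1

open Classical in
/-- The bracket `[p]`, which is `1` if `p` is true and `0` otherwise. -/
def iverson (p : Prop) : ℂ := if p then 1 else 0

/-- `x ↦ x_{21}`, the flip of the two tensor factors. -/
def flip21 {n : ℕ} (x : Mat2 n) : Mat2 n := x.submatrix Prod.swap Prod.swap

/-- `x ∧ y = x ⊗ y - y ⊗ x` -/
def wedge {n : ℕ} (x y : Matrix (Fin n) (Fin n) ℂ) : Mat2 n := x ⊗ₖ y - y ⊗ₖ x

/-- `r_s = ½ ∑ e_{ii} ⊗ e_{ii} + ∑_{α > 0} e_{-α} ⊗ e_α` -/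
def rStd (n : ℕ) : Mat2 n :=
  (1 / 2 : ℂ) • (∑ i : Fin n, eMat (i, i) ⊗ₖ eMat (i, i)) +
    ∑ i : Fin n, ∑ j : Fin n, if i < j then eMat (j, i) ⊗ₖ eMat (i, j) else 0

/-- `q^y` for `q = e^ħ`. -/
def qpow (ħ y : ℂ) : ℂ := Complex.exp (ħ * y)

/-- `q - q⁻¹` for `q = e^ħ`. -/
def qdiff (ħ : ℂ) : ℂ := Complex.exp ħ - Complex.exp (-ħ)

/-- The standard Drinfeld-Jimbo matrix
`R_s = q ∑ e_{ii} ⊗ e_{ii} + ∑_{i ≠ j} e_{ii} ⊗ e_{jj} + (q - q⁻¹) ∑_{i > j} e_{ij} ⊗ e_{ji}`. -/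
def RStd (n : ℕ) (ħ : ℂ) : Mat2 n :=
  Complex.exp ħ • (∑ i : Fin n, eMat (i, i) ⊗ₖ eMat (i, i)) +
    (∑ i : Fin n, ∑ j : Fin n, if i ≠ j then eMat (i, i) ⊗ₖ eMat (j, j) else 0) +
    qdiff ħ • ∑ i : Fin n, ∑ j : Fin n, if j < i then eMat (i, j) ⊗ₖ eMat (j, i) else 0

/-- The element `r⁰ = ∑ s_{ij} e_{ii} ⊗ e_{jj}` of `𝔥 ⊗ 𝔥`. -/
def rZero {n : ℕ} (s : Matrix (Fin n) (Fin n) ℂ) : Mat2 n :=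
  Matrix.diagonal fun p => s p.1 p.2

/-- `q^{r⁰}`; since `r⁰` is diagonal this is the entrywise exponential of the diagonal. -/
def qpowRZero {n : ℕ} (s : Matrix (Fin n) (Fin n) ℂ) (ħ : ℂ) : Mat2 n :=
  Matrix.diagonal fun p => qpow ħ (s p.1 p.2)

/-- `R_{12}`, `R_{13}`, `R_{23}`: `R` acting on two of the three factors of `ℂⁿ ⊗ ℂⁿ ⊗ ℂⁿ`. -/
def R12 {n : ℕ} (R : Mat2 n) : Matrix (Fin n × Fin n × Fin n) (Fin n × Fin n × Fin n) ℂ :=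
  Matrix.of fun a b => if a.2.2 = b.2.2 then R (a.1, a.2.1) (b.1, b.2.1) else 0

/-- See `R12`. -/
def R13 {n : ℕ} (R : Mat2 n) : Matrix (Fin n × Fin n × Fin n) (Fin n × Fin n × Fin n) ℂ :=
  Matrix.of fun a b => if a.2.1 = b.2.1 then R (a.1, a.2.2) (b.1, b.2.2) else 0

/-- See `R12`. -/
def R23 {n : ℕ} (R : Mat2 n) : Matrix (Fin n × Fin n × Fin n) (Fin n × Fin n × Fin n) ℂ :=
  Matrix.of fun a b => if a.1 = b.1 then R (a.2.1, a.2.2) (b.2.1, b.2.2) else 0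

/-- The quantum Yang-Baxter equation. -/
def QYBE {n : ℕ} (R : Mat2 n) : Prop := R12 R * R13 R * R23 R = R23 R * R13 R * R12 R

namespace BDTriple

variable {n : ℕ} (T : BDTriple n)

/-- `r⁰ = ∑ s_{ij} e_{ii} ⊗ e_{jj}` lies in `𝔥 ∧ 𝔥` and satisfies
`[(α - τ α) ⊗ 1] r⁰ = ½ [(α + τ α) ⊗ 1] P⁰` for all `α ∈ Γ₁`, where `P⁰ = ∑ e_{ii} ⊗ e_{ii}`.
A functional `λ = ∑ λ_i e_i` gives `(λ ⊗ 1) r⁰ = ∑_j (∑_i λ_i s_{ij}) e_{jj}` and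
`(λ ⊗ 1) P⁰ = ∑_j λ_j e_{jj}`; the equation compares coefficients of `e_{jj}`. -/
def IsR0 (s : Matrix (Fin n) (Fin n) ℂ) : Prop :=
  sᵀ = -s ∧ ∀ k : T.Γ₁,
    (simpleRoot k.1 - simpleRoot (T.τ k).1) ᵥ* s =
      (1 / 2 : ℂ) • (simpleRoot k.1 + simpleRoot (T.τ k).1)

/-- `α ∈ Γ̃₁` and `τ α = β`, where `τ` is extended additively: all simple roots in
`α = e_i - e_j = ∑_{i ≤ k < j} α_k` lie in `Γ₁`, and `∑_{i ≤ k < j} τ α_k = β`. -/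
def Step (α β : Fin n × Fin n) : Prop :=
  α.1 < α.2 ∧ β.1 < β.2 ∧
    (∀ k : Fin (n - 1), α.1.val ≤ k.val → k.val < α.2.val → k ∈ T.Γ₁) ∧
    (∑ k : T.Γ₁, if α.1.val ≤ k.1.val ∧ k.1.val < α.2.val then simpleRoot (T.τ k).1 else 0) =
      rootVec β

/-- `τ^m α` is defined and equals `β`. -/
def Pow : ℕ → Fin n × Fin n → Fin n × Fin n → Prop
  | 0, α, β => α = β
  | m + 1, α, β => ∃ γ, T.Step α γ ∧ Pow m γ β

/-- `α ≺ β`: `τ^m α = β` for some `m ≥ 1`. -/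
def Prec (α β : Fin n × Fin n) : Prop := ∃ m, 1 ≤ m ∧ T.Pow m α β

/-- `α ≺^← β`: for `α = e_i - e_j` with `|α| > 1` and `β = e_k - e_l = τ^m α`, the power `τ^m`
maps the first simple root `α_i` of `α` to the last simple root `α_{l-1}` of `β`. -/
def PrecRev (α β : Fin n × Fin n) : Prop :=
  1 < rootLen α ∧ ∃ m, 1 ≤ m ∧ T.Pow m α β ∧
    ∃ a b : Fin (n - 1), a.val = α.1.val ∧ b.val + 1 = β.2.val ∧
      T.Pow m (simplePair a) (simplePair b)

open Classical in
/-- `sign(α, β)` -/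
def sign (α β : Fin n × Fin n) : ℂ :=
  if T.PrecRev α β then (-1) ^ (1 - rootLen α) else 1

/-- `a = ∑_{α ≺ β} sign(α, β) e_{-α} ∧ e_β` -/
def aMat : Mat2 n :=
  ∑ α : Fin n × Fin n, ∑ β : Fin n × Fin n,
    (iverson (T.Prec α β) * T.sign α β) • wedge (eMat α.swap) (eMat β)

/-- `r = r⁰ + a + r_s` -/
def rMat (s : Matrix (Fin n) (Fin n) ℂ) : Mat2 n := rZero s + T.aMat + rStd n

/-- `ε = a r_s + r_s a + a²` -/
def epsMat : Mat2 n := T.aMat * rStd n + rStd n * T.aMat + T.aMat * T.aMat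

/-- `ã`, whose entries are `a_{ik}^{jl} q^{a_{ik}^{jl} ε_{ik}^{jl}}`. -/
def aTilde (ħ : ℂ) : Mat2 n :=
  Matrix.of fun x y => T.aMat x y * qpow ħ (T.aMat x y * T.epsMat x y)

/-- `R_GGS = q^{r⁰} (R_s + (q - q⁻¹) ã) q^{r⁰}` -/
def RGGS (s : Matrix (Fin n) (Fin n) ℂ) (ħ : ℂ) : Mat2 n :=
  qpowRZero s ħ * (RStd n ħ + qdiff ħ • T.aTilde ħ) * qpowRZero s ħ

/-- The defining property of the GGS `R`-matrix, as a function of `ħ`: every entry has the form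
`x q^y (q - q⁻¹)^z` with `x, y ∈ ℂ` and `z ∈ {0, 1}`, and `R ≡ 1 + 2ħr + 2ħ²r² (mod ħ³)`. -/
def IsGGS (s : Matrix (Fin n) (Fin n) ℂ) (R : ℂ → Mat2 n) : Prop :=
  (∀ u v, ∃ x y : ℂ, ∃ z : ℕ, (z = 0 ∨ z = 1) ∧
    ∀ ħ, R ħ u v = x * qpow ħ y * qdiff ħ ^ z) ∧
  ∀ u v, (fun ħ : ℂ => R ħ u v -
      (1 + (2 * ħ) • T.rMat s + (2 * ħ ^ 2) • (T.rMat s * T.rMat s) : Mat2 n) u v)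
    =O[nhds 0] fun ħ => ħ ^ 3

/-- The half-integers
`K_{α,β} = ½[α ⋖ β, α ≺ β] - ½[α ⋗ β, α ≺ β] + [∃ γ, α ≺ γ ≺ β, α ⋖ γ]
  - [∃ γ, α ≺ γ ≺ β, α ⋗ γ] + [α ≺^← β] (1 - |α|)`. -/
def K (α β : Fin n × Fin n) : ℂ :=
  1 / 2 * iverson (Lessdot α β ∧ T.Prec α β) - 1 / 2 * iverson (Lessdot β α ∧ T.Prec α β) +
    iverson (∃ γ, T.Prec α γ ∧ T.Prec γ β ∧ Lessdot α γ) -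
    iverson (∃ γ, T.Prec α γ ∧ T.Prec γ β ∧ Lessdot γ α) +
    iverson (T.PrecRev α β) * (1 - (rootLen α : ℂ))

/-- `A^m = (q - q⁻¹) ∑_{β = τ^m α} sign(α, β) q^{K_{α,β}} e_β ⊗ e_{-α}` -/
def AMat (m : ℕ) (ħ : ℂ) : Mat2 n :=
  qdiff ħ • ∑ α : Fin n × Fin n, ∑ β : Fin n × Fin n,
    (iverson (T.Pow m α β) * T.sign α β * qpow ħ (T.K α β)) • (eMat β ⊗ₖ eMat α.swap)

/-- `J = J^1 J^2 ⋯` with `J^m = 1 + A^m`. The product stops at `m = n`: `τ^m` is nowhere defined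
for `m ≥ n - 1`, so all further factors are `1`. -/
def JMat (ħ : ℂ) : Mat2 n :=
  ((List.range n).map fun m => 1 + T.AMat (m + 1) ħ).prod

/-- `R_J = q^{r⁰} J⁻¹ R_s J_{21} q^{r⁰}` -/
def RJ (s : Matrix (Fin n) (Fin n) ℂ) (ħ : ℂ) : Mat2 n :=
  qpowRZero s ħ * ((T.JMat ħ)⁻¹ * RStd n ħ * flip21 (T.JMat ħ)) * qpowRZero s ħ

end BDTriple

end GGS

end

/-!
For the Cremmer-Gervais triple, `α ≺ β` holds exactly when `β` is a translate of `α` to the right.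
Hence `a` has a nonzero entry at `e_{ij} ⊗ e_{kl}` exactly when `i + k = j + l` and `i`, `k` lie
strictly between `j` and `l`, and this entry is the sign of `l - j`. In other words
`a = N (1 - P)`, where `P` is the flip and `N` the indicator matrix of `i`, `k` lying strictly
between `j < l`. All matrices involved are built from `N`, `P` and diagonal matrices depending only
on the order of a pair, and `P N = N`; in particular `a² = 0`.

* Part 1: a function `x q^y (q - q⁻¹)^z` is determined by its 2-jet at `ħ = 0`, which gives
  uniqueness. For existence, the 2-jets agree because `ε` is supported where `a` has the
  entries `±1`, so that the second order term `a_{uv}² ε_{uv}` of `(q - q⁻¹) ã` is `ε_{uv}`.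
* Part 2: `A^m A^{m'} = 0` for `m' ≤ m`, hence the inverse of the product of the `1 + A^m` is
  `1 - ∑ A^m`. Then `J⁻¹ R_s = (R_s + (q - q⁻¹) ã) J₂₁⁻¹` follows from `P N = N`.
* Part 3: any two solutions `r⁰` have coefficients differing by a multiple of `j - i`, which twists
  `R` by a diagonal matrix and preserves the Yang-Baxter equation. For one solution, `R` acts on the
  row vectors of the monomials in two variables as a Demazure-Lusztig operator, and the Yang-Baxter
  equation reduces to an identity of such operators in three variables.

The anti-automorphism `x ↦ (x₂₁)ᵀ` preserves `R_s` and carries `R_GGS` of the triple to that of its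
inverse, with `s` transposed. It carries `J⁻¹` at `-ħ` to `J` of the inverse triple, and part 2 for
the inverse triple follows since `R_GGS` at `-ħ` is the inverse of `R_GGS` at `ħ`.
-/

noncomputable section

namespace GGS

section FlipCalculus

variable {n : ℕ}

/-- The anti-automorphism `x ↦ (x_{21})ᵀ` of `Mat_n(ℂ) ⊗ Mat_n(ℂ)`. -/
def antiflip (x : Mat2 n) : Mat2 n := (flip21 x)ᵀ

theorem antiflip_apply (x : Mat2 n) (u v : Fin n × Fin n) :
    antiflip x u v = x v.swap u.swap := rfl

theorem antiflip_add (x y : Mat2 n) : antiflip (x + y) = antiflip x + antiflip y := rfl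

theorem antiflip_smul (c : ℂ) (x : Mat2 n) : antiflip (c • x) = c • antiflip x := rfl

theorem antiflip_neg (x : Mat2 n) : antiflip (-x) = -antiflip x := rfl

theorem antiflip_flip21 (x : Mat2 n) : antiflip (flip21 x) = flip21 (antiflip x) := rfl

theorem flip21_mul (x y : Mat2 n) : flip21 (x * y) = flip21 x * flip21 y :=
  submatrix_mul x y _ _ _ Prod.swap_bijective

theorem flip21_one : flip21 (1 : Mat2 n) = 1 :=
  submatrix_one _ Prod.swap_injective

theorem antiflip_mul (x y : Mat2 n) : antiflip (x * y) = antiflip y * antiflip x := by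
  simp only [antiflip, flip21_mul, transpose_mul]

theorem antiflip_one : antiflip (1 : Mat2 n) = 1 := by
  rw [antiflip, flip21_one, transpose_one]

theorem flip21_inv (x : Mat2 n) : flip21 x⁻¹ = (flip21 x)⁻¹ :=
  (inv_submatrix_equiv x (Equiv.prodComm _ _) (Equiv.prodComm _ _)).symm

theorem antiflip_inv (x : Mat2 n) : antiflip x⁻¹ = (antiflip x)⁻¹ := by
  rw [antiflip, antiflip, flip21_inv, transpose_nonsing_inv]

/-- The flip of `ℂⁿ ⊗ ℂⁿ`. -/
def swapMat (n : ℕ) : Mat2 n := (1 : Mat2 n).submatrix Prod.swap id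

theorem swapMat_eq_submatrix_id_swap :
    swapMat n = (1 : Mat2 n).submatrix id Prod.swap := by
  ext u v
  simp only [swapMat, submatrix_apply, id_eq, one_apply, Prod.swap_eq_iff_eq_swap]

theorem mul_swapMat (x : Mat2 n) : x * swapMat n = x.submatrix id Prod.swap :=
  mul_submatrix_one (Equiv.prodComm _ _) id x

theorem swapMat_mul (x : Mat2 n) : swapMat n * x = x.submatrix Prod.swap id := by
  rw [swapMat_eq_submatrix_id_swap]
  exact one_submatrix_mul id (Equiv.prodComm _ _) x

theorem swapMat_mul_swapMat : swapMat n * swapMat n = 1 := by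
  rw [mul_swapMat, swapMat_eq_submatrix_id_swap, submatrix_submatrix]
  exact submatrix_id_id _

theorem flip21_eq (x : Mat2 n) : flip21 x = swapMat n * x * swapMat n := by
  rw [swapMat_mul, mul_swapMat]
  rfl

theorem antiflip_swapMat : antiflip (swapMat n) = swapMat n := by
  ext u v
  simp only [antiflip_apply, swapMat, submatrix_apply, id_eq, one_apply, Prod.swap_swap,
    eq_comm (a := u), Prod.swap_eq_iff_eq_swap]

/-- The function of `u` equal to `x`, `y`, `z` according to whether `u.1 < u.2`, `u.1 = u.2` or
`u.1 > u.2`. -/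
def byOrder (x y z : ℂ) (u : Fin n × Fin n) : ℂ :=
  if u.1 < u.2 then x else if u.1 = u.2 then y else z

theorem byOrder_const (c : ℂ) (u : Fin n × Fin n) : byOrder c c c u = c := by
  simp only [byOrder, ite_self]

theorem byOrder_of_lt {x y z : ℂ} {u : Fin n × Fin n} (h : u.1 < u.2) : byOrder x y z u = x :=
  if_pos h

theorem byOrder_of_eq {x y z : ℂ} {u : Fin n × Fin n} (h : u.1 = u.2) : byOrder x y z u = y := by
  rw [byOrder, if_neg h.not_lt, if_pos h]

theorem byOrder_of_gt {x y z : ℂ} {u : Fin n × Fin n} (h : u.2 < u.1) : byOrder x y z u = z := by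
  rw [byOrder, if_neg h.not_gt, if_neg h.ne']

theorem eq_byOrder {x y z : ℂ} {f : Fin n × Fin n → ℂ} (hlt : ∀ u, u.1 < u.2 → f u = x)
    (heq : ∀ u, u.1 = u.2 → f u = y) (hgt : ∀ u, u.2 < u.1 → f u = z) : f = byOrder x y z := by
  ext u
  rcases lt_trichotomy u.1 u.2 with h | h | h
  · rw [hlt u h, byOrder_of_lt h]
  · rw [heq u h, byOrder_of_eq h]
  · rw [hgt u h, byOrder_of_gt h]

theorem byOrder_swap (x y z : ℂ) (u : Fin n × Fin n) :
    byOrder x y z u.swap = byOrder z y x u :=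
  congrFun (eq_byOrder (f := fun u : Fin n × Fin n => byOrder x y z u.swap)
    (fun _ h => byOrder_of_gt h) (fun _ h => byOrder_of_eq h.symm) fun _ h => byOrder_of_lt h) u

theorem map_byOrder (f : ℂ → ℂ) (x y z : ℂ) (u : Fin n × Fin n) :
    f (byOrder x y z u) = byOrder (f x) (f y) (f z) u := by
  simp only [byOrder, apply_ite f]

theorem map₂_byOrder (f : ℂ → ℂ → ℂ) (x y z x' y' z' : ℂ) (u : Fin n × Fin n) :
    f (byOrder x y z u) (byOrder x' y' z' u) = byOrder (f x x') (f y y') (f z z') u := by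
  unfold byOrder
  split_ifs <;> rfl

/-- The diagonal matrix with entries `byOrder x y z`. -/
def orderDiag (n : ℕ) (x y z : ℂ) : Mat2 n := diagonal (byOrder x y z)

theorem orderDiag_apply (x y z : ℂ) (u v : Fin n × Fin n) :
    orderDiag n x y z u v = if u = v then byOrder x y z u else 0 :=
  diagonal_apply _ _ _

theorem orderDiag_mul (x y z x' y' z' : ℂ) :
    orderDiag n x y z * orderDiag n x' y' z' = orderDiag n (x * x') (y * y') (z * z') := by
  simp only [orderDiag, diagonal_mul_diagonal, map₂_byOrder (· * ·)]

theorem orderDiag_add (x y z x' y' z' : ℂ) :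
    orderDiag n x y z + orderDiag n x' y' z' = orderDiag n (x + x') (y + y') (z + z') := by
  simp only [orderDiag, diagonal_add, map₂_byOrder (· + ·)]

theorem orderDiag_const (c : ℂ) : orderDiag n c c c = c • 1 := by
  simp only [orderDiag, smul_one_eq_diagonal, funext fun u => byOrder_const c u]

theorem orderDiag_one : orderDiag n 1 1 1 = 1 := by
  rw [orderDiag_const, one_smul]

theorem orderDiag_zero : orderDiag n 0 0 0 = 0 := by
  rw [orderDiag_const, zero_smul]

theorem smul_orderDiag (c x y z : ℂ) :
    c • orderDiag n x y z = orderDiag n (c * x) (c * y) (c * z) := by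
  rw [← orderDiag_mul, orderDiag_const, smul_mul_assoc, one_mul]

theorem orderDiag_mul_swapMat_apply (x y z : ℂ) (u v : Fin n × Fin n) :
    (orderDiag n x y z * swapMat n) u v = if u = v.swap then byOrder x y z u else 0 := by
  rw [mul_swapMat, submatrix_apply, orderDiag_apply, id_eq]

theorem swapMat_mul_orderDiag (x y z : ℂ) :
    swapMat n * orderDiag n x y z = orderDiag n z y x * swapMat n := by
  rw [swapMat_mul, mul_swapMat]
  ext u v
  simp only [orderDiag, submatrix_apply, id_eq, diagonal_apply, byOrder_swap,
    Prod.swap_eq_iff_eq_swap]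

theorem antiflip_orderDiag (x y z : ℂ) : antiflip (orderDiag n x y z) = orderDiag n z y x := by
  ext u v
  simp only [antiflip_apply, orderDiag, diagonal_apply, byOrder_swap, Prod.swap_inj,
    eq_comm (a := v)]
  split_ifs with h
  · rw [h]
  · rfl

theorem antiflip_orderDiag_mul_swapMat (x y z : ℂ) :
    antiflip (orderDiag n x y z * swapMat n) = orderDiag n x y z * swapMat n := by
  rw [antiflip_mul, antiflip_swapMat, antiflip_orderDiag, swapMat_mul_orderDiag]

end FlipCalculus

section StandardMatrices

variable {n : ℕ}

theorem eMat_kronecker_eMat (α β : Fin n × Fin n) :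
    eMat α ⊗ₖ eMat β = single (α.1, β.1) (α.2, β.2) 1 := by
  rw [eMat, eMat, single_kronecker_single, mul_one]

theorem sum_smul_eMat_kronecker_eMat_swap_apply (f : Fin n × Fin n → Fin n × Fin n → ℂ)
    (u v : Fin n × Fin n) :
    (∑ α, ∑ β, f α β • (eMat β ⊗ₖ eMat α.swap)) u v = f (v.2, u.2) (u.1, v.1) := by
  simp only [Matrix.sum_apply, Matrix.smul_apply, eMat_kronecker_eMat, single_apply,
    Fintype.sum_prod_type, Prod.ext_iff, smul_eq_mul, mul_ite, mul_one, mul_zero, ite_and,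
    Finset.sum_ite_irrel, Finset.sum_ite_eq', Finset.mem_univ, if_true,
    Prod.fst_swap, Prod.snd_swap, Finset.sum_const_zero]

theorem sum_smul_eMat_swap_kronecker_eMat_apply (f : Fin n × Fin n → Fin n × Fin n → ℂ)
    (u v : Fin n × Fin n) :
    (∑ α, ∑ β, f α β • (eMat α.swap ⊗ₖ eMat β)) u v = f (v.1, u.1) (u.2, v.2) := by
  simp only [Matrix.sum_apply, Matrix.smul_apply, eMat_kronecker_eMat, single_apply,
    Fintype.sum_prod_type, Prod.ext_iff, smul_eq_mul, mul_ite, mul_one, mul_zero, ite_and,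
    Finset.sum_ite_irrel, Finset.sum_ite_eq', Finset.mem_univ, if_true,
    Prod.fst_swap, Prod.snd_swap, Finset.sum_const_zero]

theorem sum_ite_eMat_diag_kronecker_eMat_diag (p : Fin n → Fin n → Prop) [DecidableRel p] :
    (∑ i, ∑ j, if p i j then eMat (i, i) ⊗ₖ eMat (j, j) else 0) =
      diagonal fun u => if p u.1 u.2 then 1 else 0 := by
  simp only [eMat_kronecker_eMat]
  rw [← Matrix.sum_single_eq_diagonal, Fintype.sum_prod_type]
  simp only [apply_ite (single _ _), single_zero]

theorem sum_ite_eMat_kronecker_eMat_swap (p : Fin n → Fin n → Prop) [DecidableRel p] :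
    (∑ i, ∑ j, if p i j then eMat (i, j) ⊗ₖ eMat (j, i) else 0) =
      (diagonal fun u => if p u.1 u.2 then 1 else 0) * swapMat n := by
  rw [← sum_ite_eMat_diag_kronecker_eMat_diag, mul_swapMat]
  ext u v
  simp only [eMat_kronecker_eMat, submatrix_apply, Matrix.sum_apply]
  refine Finset.sum_congr rfl fun i _ => Finset.sum_congr rfl fun j _ => ?_
  split_ifs
  · simp only [single_apply, id_eq, Prod.ext_iff, Prod.fst_swap, Prod.snd_swap,
      and_comm (a := i = v.2)]
  · rfl

theorem sum_eMat_diag_kronecker_self :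
    ∑ i : Fin n, eMat (i, i) ⊗ₖ eMat (i, i) = orderDiag n 0 1 0 := by
  have h := sum_ite_eMat_diag_kronecker_eMat_diag (fun i j : Fin n => i = j)
  simp only [Finset.sum_ite_eq, Finset.mem_univ, if_true] at h
  rw [h, orderDiag]
  congr 1
  exact eq_byOrder (fun _ h => if_neg h.ne) (fun _ h => if_pos h) fun _ h => if_neg h.ne'

theorem sum_eMat_kronecker_eMat_of_gt :
    (∑ i : Fin n, ∑ j : Fin n, if j < i then eMat (i, j) ⊗ₖ eMat (j, i) else 0) =
      orderDiag n 0 0 1 * swapMat n := by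
  rw [sum_ite_eMat_kronecker_eMat_swap fun i j => j < i, orderDiag]
  congr 2
  exact eq_byOrder (fun _ h => if_neg h.not_gt) (fun _ h => if_neg h.not_gt) fun _ h => if_pos h

theorem sum_eMat_diag_kronecker_of_ne :
    (∑ i : Fin n, ∑ j : Fin n, if i ≠ j then eMat (i, i) ⊗ₖ eMat (j, j) else 0) =
      orderDiag n 1 0 1 := by
  rw [sum_ite_eMat_diag_kronecker_eMat_diag fun i j => i ≠ j, orderDiag]
  congr 1
  exact eq_byOrder (fun _ h => if_pos h.ne) (fun _ h => if_neg (not_not.2 h))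
    fun _ h => if_pos h.ne'

theorem rStd_eq : rStd n = orderDiag n 0 (1 / 2) 0 + orderDiag n 0 0 1 * swapMat n := by
  rw [rStd, sum_eMat_diag_kronecker_self, Finset.sum_comm, sum_eMat_kronecker_eMat_of_gt,
    smul_orderDiag, mul_zero, mul_one]

theorem rStd_mul_rStd : rStd n * rStd n = orderDiag n 0 (1 / 4) 0 := by
  rw [rStd_eq, add_mul, mul_add, mul_add, orderDiag_mul, ← mul_assoc, orderDiag_mul, mul_assoc,
    swapMat_mul_orderDiag, ← mul_assoc, orderDiag_mul, mul_assoc (orderDiag n 0 0 1),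
    ← mul_assoc (swapMat n), swapMat_mul_orderDiag, mul_assoc (orderDiag n 1 0 0),
    swapMat_mul_swapMat, mul_one]
  norm_num [orderDiag_mul, orderDiag_zero]

theorem rStd_apply_self (u : Fin n × Fin n) : rStd n u u = byOrder 0 (1 / 2) 0 u := by
  rw [rStd_eq, Matrix.add_apply, orderDiag_apply, if_pos rfl, orderDiag_mul_swapMat_apply,
    add_eq_left, ite_eq_right_iff]
  exact fun h => byOrder_of_eq (congrArg Prod.fst h)

theorem rStd_apply_of_ne {u v : Fin n × Fin n} (h : u ≠ v) :
    rStd n u v = if u = v.swap then byOrder 0 0 1 u else 0 := by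
  rw [rStd_eq, Matrix.add_apply, orderDiag_apply, if_neg h, zero_add, orderDiag_mul_swapMat_apply]

/-- The standard matrix `R_s` as a function of `q`. -/
def stdR (n : ℕ) (q : ℂ) : Mat2 n :=
  orderDiag n 1 q 1 + orderDiag n 0 0 (q - q⁻¹) * swapMat n

theorem RStd_eq (ħ : ℂ) : RStd n ħ = stdR n (Complex.exp ħ) := by
  rw [RStd, sum_eMat_diag_kronecker_self, sum_eMat_diag_kronecker_of_ne,
    sum_eMat_kronecker_eMat_of_gt, qdiff, Complex.exp_neg, stdR, ← smul_mul_assoc, smul_orderDiag,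
    smul_orderDiag, orderDiag_add]
  simp only [mul_zero, mul_one, zero_add, add_zero]

theorem stdR_mul_stdR_inv {q : ℂ} (hq : q ≠ 0) : stdR n q * stdR n q⁻¹ = 1 := by
  have h : orderDiag n 0 0 (q - q⁻¹) * swapMat n * (orderDiag n 0 0 (q⁻¹ - q⁻¹⁻¹) * swapMat n) =
      0 := by
    rw [mul_assoc, ← mul_assoc (swapMat n), swapMat_mul_orderDiag, mul_assoc, swapMat_mul_swapMat,
      mul_one, orderDiag_mul]
    simp only [zero_mul, mul_zero, orderDiag_zero]
  rw [stdR, stdR, add_mul, mul_add, mul_add, h, add_zero, ← mul_assoc, orderDiag_mul,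
    orderDiag_mul, mul_assoc (orderDiag n 0 0 (q - q⁻¹)), swapMat_mul_orderDiag, ← mul_assoc,
    orderDiag_mul, add_assoc, ← add_mul, orderDiag_add]
  simp [mul_inv_cancel₀ hq, orderDiag_one, orderDiag_zero]

theorem antiflip_stdR (q : ℂ) : antiflip (stdR n q) = stdR n q := by
  rw [stdR, antiflip_add, antiflip_orderDiag, antiflip_orderDiag_mul_swapMat]

theorem antiflip_rStd : antiflip (rStd n) = rStd n := by
  rw [rStd_eq, antiflip_add, antiflip_orderDiag, antiflip_orderDiag_mul_swapMat]

end StandardMatrices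

section Qpow

theorem qpow_zero (ħ : ℂ) : qpow ħ 0 = 1 := by
  rw [qpow, mul_zero, Complex.exp_zero]

theorem qpow_one (ħ : ℂ) : qpow ħ 1 = Complex.exp ħ := by
  rw [qpow, mul_one]

theorem qpow_add (ħ x y : ℂ) : qpow ħ (x + y) = qpow ħ x * qpow ħ y := by
  rw [qpow, mul_add, Complex.exp_add, qpow, qpow]

theorem qpow_neg (ħ x : ℂ) : qpow ħ (-x) = (qpow ħ x)⁻¹ := by
  rw [qpow, mul_neg, Complex.exp_neg, qpow]

theorem qpow_neg_left (ħ x : ℂ) : qpow (-ħ) x = (qpow ħ x)⁻¹ := by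
  rw [qpow, neg_mul, Complex.exp_neg, qpow]

theorem qpow_ne_zero (ħ x : ℂ) : qpow ħ x ≠ 0 := Complex.exp_ne_zero _

theorem qpow_half_sq (ħ : ℂ) : qpow ħ (1 / 2) ^ 2 = Complex.exp ħ := by
  rw [sq, ← qpow_add, add_halves, qpow_one]

theorem qdiff_eq (ħ : ℂ) : qdiff ħ = Complex.exp ħ - (Complex.exp ħ)⁻¹ := by
  rw [qdiff, Complex.exp_neg]

theorem qdiff_neg (ħ : ℂ) : qdiff (-ħ) = -qdiff ħ := by
  rw [qdiff, qdiff, neg_neg, neg_sub]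

variable {n : ℕ}

theorem RStd_mul_RStd_neg (ħ : ℂ) : RStd n ħ * RStd n (-ħ) = 1 := by
  rw [RStd_eq, RStd_eq, Complex.exp_neg, stdR_mul_stdR_inv (Complex.exp_ne_zero ħ)]

theorem antiflip_RStd (ħ : ℂ) : antiflip (RStd n ħ) = RStd n ħ := by
  rw [RStd_eq, antiflip_stdR]

theorem RStd_apply_self (ħ : ℂ) (u : Fin n × Fin n) : RStd n ħ u u = qpow ħ (byOrder 0 1 0 u) := by
  rw [RStd_eq, stdR, Matrix.add_apply, orderDiag_apply, if_pos rfl, orderDiag_mul_swapMat_apply,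
    map_byOrder (qpow ħ), qpow_zero, qpow_one, add_eq_left, ite_eq_right_iff]
  exact fun h => byOrder_of_eq (congrArg Prod.fst h)

theorem RStd_apply_of_ne (ħ : ℂ) {u v : Fin n × Fin n} (h : u ≠ v) :
    RStd n ħ u v = rStd n u v * qdiff ħ := by
  rw [RStd_eq, stdR, Matrix.add_apply, orderDiag_apply, if_neg h, zero_add, rStd_apply_of_ne h,
    orderDiag_mul_swapMat_apply, ← qdiff_eq, ite_mul, zero_mul, map_byOrder (· * qdiff ħ), zero_mul,
    one_mul]

theorem qpowRZero_mul_qpowRZero_neg (s : Matrix (Fin n) (Fin n) ℂ) (ħ : ℂ) :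
    qpowRZero s ħ * qpowRZero s (-ħ) = 1 := by
  simp only [qpowRZero, diagonal_mul_diagonal, qpow_neg_left, mul_inv_cancel₀ (qpow_ne_zero _ _),
    diagonal_one]

theorem antiflip_qpowRZero (s : Matrix (Fin n) (Fin n) ℂ) (ħ : ℂ) :
    antiflip (qpowRZero s ħ) = qpowRZero sᵀ ħ := by
  ext u v
  simp only [antiflip_apply, qpowRZero, diagonal_apply, Prod.swap_inj, eq_comm (a := v)]
  split_ifs with h
  · rw [h]; rfl
  · rfl

end Qpow

section InsideCalculus

variable {n : ℕ}

theorem iverson_true {p : Prop} (h : p) : iverson p = 1 := if_pos h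

theorem iverson_false {p : Prop} (h : ¬p) : iverson p = 0 := if_neg h

/-- `v` is an increasing pair with the same midpoint as the unordered pair `u`, which lies strictly
between the entries of `v`. -/
def Inside (u v : Fin n × Fin n) : Prop :=
  u.1.val + u.2.val = v.1.val + v.2.val ∧ v.1 < u.1 ∧ v.1 < u.2

theorem inside_swap_left {u v : Fin n × Fin n} : Inside u.swap v ↔ Inside u v := by
  simp only [Inside, Prod.fst_swap, Prod.snd_swap]
  rw [add_comm, and_comm (a := v.1 < u.2)]

theorem Inside.lt {u v : Fin n × Fin n} (h : Inside u v) : v.1 < v.2 := by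
  obtain ⟨h₁, h₂, h₃⟩ := h
  rw [Fin.lt_def] at *
  omega

theorem Inside.not_swap {u v : Fin n × Fin n} (h : Inside u v) : ¬Inside u v.swap :=
  fun h' => h.lt.not_gt h'.lt

/-- The indicator matrix of `Inside`. -/
def insideMat (n : ℕ) : Mat2 n := Matrix.of fun u v => iverson (Inside u v)

theorem insideMat_apply (u v : Fin n × Fin n) : insideMat n u v = iverson (Inside u v) := rfl

theorem swapMat_mul_insideMat : swapMat n * insideMat n = insideMat n := by
  rw [swapMat_mul]
  ext u v
  simp only [submatrix_apply, id_eq, insideMat_apply, inside_swap_left]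

theorem insideMat_mul_orderDiag (x y z : ℂ) :
    insideMat n * orderDiag n x y z = x • insideMat n := by
  ext u v
  rw [orderDiag, mul_diagonal, Matrix.smul_apply, smul_eq_mul, insideMat_apply, mul_comm]
  by_cases h : Inside u v
  · rw [byOrder_of_lt h.lt]
  · rw [iverson_false h, mul_zero, mul_zero]

theorem insideMat_mul_swapMat_mul_orderDiag (x y z : ℂ) :
    insideMat n * swapMat n * orderDiag n x y z = z • (insideMat n * swapMat n) := by
  rw [mul_assoc, swapMat_mul_orderDiag, ← mul_assoc, insideMat_mul_orderDiag, smul_mul_assoc]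

/-- The combination `N (x - y P)` of the matrix `N` of `Inside` and the flip `P`. -/
def insideComb (n : ℕ) (x y : ℂ) : Mat2 n := insideMat n * (x • 1 - y • swapMat n)

theorem insideComb_eq (x y : ℂ) :
    insideComb n x y = x • insideMat n - y • (insideMat n * swapMat n) := by
  rw [insideComb, mul_sub, mul_smul_comm, mul_smul_comm, mul_one]

theorem insideComb_apply (x y : ℂ) (u v : Fin n × Fin n) :
    insideComb n x y u v = x * iverson (Inside u v) - y * iverson (Inside u v.swap) := by
  rw [insideComb_eq, mul_swapMat]
  rfl

theorem insideComb_add (x y x' y' : ℂ) :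
    insideComb n x y + insideComb n x' y' = insideComb n (x + x') (y + y') := by
  simp only [insideComb_eq, add_smul]
  abel

theorem smul_insideComb (c x y : ℂ) : c • insideComb n x y = insideComb n (c * x) (c * y) := by
  simp only [insideComb_eq, smul_sub, smul_smul]

theorem insideComb_mul_swapMat (x y : ℂ) :
    insideComb n x y * swapMat n = insideComb n (-y) (-x) := by
  rw [insideComb_eq, insideComb_eq, sub_mul, smul_mul_assoc, smul_mul_assoc, mul_assoc,
    swapMat_mul_swapMat, mul_one]
  simp only [neg_smul]
  abel

theorem insideComb_mul_orderDiag (x y a b c : ℂ) :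
    insideComb n x y * orderDiag n a b c = insideComb n (x * a) (y * c) := by
  simp only [insideComb_eq, sub_mul, smul_mul_assoc, insideMat_mul_orderDiag,
    insideMat_mul_swapMat_mul_orderDiag, smul_smul]

theorem swapMat_mul_insideComb (x y : ℂ) : swapMat n * insideComb n x y = insideComb n x y := by
  rw [insideComb, ← mul_assoc, swapMat_mul_insideMat]

theorem insideComb_self_mul_insideMat (x : ℂ) : insideComb n x x * insideMat n = 0 := by
  rw [insideComb, mul_assoc, sub_mul, smul_mul_assoc, smul_mul_assoc, one_mul,
    swapMat_mul_insideMat, sub_self, mul_zero]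

theorem insideComb_self_mul_insideComb (x y z : ℂ) :
    insideComb n x x * insideComb n y z = 0 := by
  have hfactor : insideComb n y z = insideMat n * (y • 1 - z • swapMat n) := rfl
  rw [hfactor, ← mul_assoc, insideComb_self_mul_insideMat, zero_mul]

end InsideCalculus

section CremmerGervaisCore

variable {n : ℕ}

/-- The matrix `ã` of the Cremmer-Gervais triple, as a function of `r = q^{1/2}`. -/
def cgTilde (n : ℕ) (r : ℂ) : Mat2 n := orderDiag n 1 r (r ^ 2) * insideComb n (r ^ 2)⁻¹ 1

/-- The matrix `R_s + (q - q⁻¹) ã` of the Cremmer-Gervais triple, as a function of `r = q^{1/2}`. -/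
def cgCore (n : ℕ) (r : ℂ) : Mat2 n :=
  stdR n (r ^ 2) + (r ^ 2 - (r ^ 2)⁻¹) • cgTilde n r

/-- The matrix `∑ A^m = 1 - J⁻¹` of the Cremmer-Gervais triple, as a function of `r = q^{1/2}`. -/
def cgA (n : ℕ) (r : ℂ) : Mat2 n :=
  (r ^ 2 - (r ^ 2)⁻¹) • (orderDiag n 1 r (r ^ 2) * insideComb n 0 (-1))

theorem cgTilde_mul_orderDiag_mul_insideComb {r : ℂ} (a b c x y : ℂ) (h : (r ^ 2)⁻¹ * a = c) :
    cgTilde n r * (orderDiag n a b c * insideComb n x y) = 0 := by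
  rw [cgTilde, mul_assoc, ← mul_assoc (insideComb n _ _), insideComb_mul_orderDiag, h, one_mul,
    insideComb_self_mul_insideComb, mul_zero]

theorem flip21_cgA (r : ℂ) :
    flip21 (cgA n r) =
      (r ^ 2 - (r ^ 2)⁻¹) • (orderDiag n (r ^ 2) r 1 * insideComb n 1 0) := by
  rw [flip21_eq, cgA, mul_smul_comm, smul_mul_assoc, ← mul_assoc, swapMat_mul_orderDiag,
    mul_assoc _ (swapMat n), swapMat_mul_insideComb, mul_assoc, insideComb_mul_swapMat, neg_neg,
    neg_zero]

theorem stdR_mul_insideComb (q a b c x y : ℂ) :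
    stdR n q * (orderDiag n a b c * insideComb n x y) =
      orderDiag n a (q * b) (c + (q - q⁻¹) * a) * insideComb n x y := by
  rw [stdR, add_mul, ← mul_assoc, orderDiag_mul, mul_assoc _ (swapMat n), ← mul_assoc (swapMat n),
    swapMat_mul_orderDiag, mul_assoc _ (swapMat n), swapMat_mul_insideComb, ← mul_assoc,
    orderDiag_mul, ← add_mul, orderDiag_add]
  simp only [zero_mul, one_mul, add_zero]

theorem insideComb_mul_stdR (q x y : ℂ) :
    insideComb n x y * stdR n q = insideComb n (x - y * (q - q⁻¹)) y := by
  rw [stdR, mul_add, ← mul_assoc, insideComb_mul_orderDiag, insideComb_mul_orderDiag,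
    insideComb_mul_swapMat, insideComb_add]
  simp only [mul_zero, mul_one, neg_zero, add_zero, sub_eq_add_neg]

theorem one_sub_cgA_mul_stdR {r : ℂ} (hr : r ≠ 0) :
    (1 - cgA n r) * stdR n (r ^ 2) = cgCore n r * (1 - flip21 (cgA n r)) := by
  have hzero : cgTilde n r * flip21 (cgA n r) = 0 := by
    rw [flip21_cgA, mul_smul_comm, cgTilde_mul_orderDiag_mul_insideComb, smul_zero]
    field_simp
  have hleft : cgA n r * stdR n (r ^ 2) = (r ^ 2 - (r ^ 2)⁻¹) •
      (orderDiag n 1 r (r ^ 2) * insideComb n (r ^ 2 - (r ^ 2)⁻¹) (-1)) := by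
    rw [cgA, smul_mul_assoc, mul_assoc, insideComb_mul_stdR]
    simp only [neg_mul, one_mul, sub_neg_eq_add, zero_add]
  have hright : stdR n (r ^ 2) * flip21 (cgA n r) = (r ^ 2 - (r ^ 2)⁻¹) •
      (orderDiag n 1 r (r ^ 2) * insideComb n (r ^ 2) 0) := by
    have hscale : orderDiag n (r ^ 2) (r ^ 2 * r) (1 + (r ^ 2 - (r ^ 2)⁻¹) * r ^ 2) =
        r ^ 2 • orderDiag n 1 r (r ^ 2) := by
      rw [smul_orderDiag]
      congr 1 <;> field_simp
      ring
    rw [flip21_cgA, mul_smul_comm, stdR_mul_insideComb, hscale, smul_mul_assoc, ← mul_smul_comm,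
      smul_insideComb, mul_one, mul_zero]
  have hcomb : orderDiag n 1 r (r ^ 2) * insideComb n (r ^ 2 - (r ^ 2)⁻¹) (-1) + cgTilde n r =
      orderDiag n 1 r (r ^ 2) * insideComb n (r ^ 2) 0 := by
    rw [cgTilde, ← mul_add, insideComb_add, sub_add_cancel, neg_add_cancel]
  rw [cgCore, sub_mul, one_mul, mul_sub, mul_one, add_mul, smul_mul_assoc, hzero, smul_zero,
    add_zero, hleft, hright, ← hcomb, smul_add]
  abel

theorem cgCore_mul_cgCore_inv {r : ℂ} (hr : r ≠ 0) : cgCore n r * cgCore n r⁻¹ = 1 := by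
  have hsq : (r⁻¹) ^ 2 = (r ^ 2)⁻¹ := inv_pow r 2
  have hzero : cgTilde n r * cgTilde n r⁻¹ = 0 :=
    cgTilde_mul_orderDiag_mul_insideComb _ _ _ _ _ (by rw [hsq, mul_one])
  have hcomm : stdR n (r ^ 2) * cgTilde n r⁻¹ = cgTilde n r * stdR n (r ^ 2)⁻¹ := by
    rw [cgTilde, stdR_mul_insideComb, cgTilde, mul_assoc, insideComb_mul_stdR, hsq]
    congr 2 <;> field_simp <;> ring
  rw [cgCore, cgCore, hsq, inv_inv, add_mul, mul_add, mul_add, stdR_mul_stdR_inv (pow_ne_zero 2 hr),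
    smul_mul_smul_comm, hzero, smul_zero, add_zero, mul_smul_comm, hcomm, smul_mul_assoc, add_assoc,
    ← add_smul, sub_add_sub_cancel, sub_self, zero_smul, add_zero]

/-- The Cremmer-Gervais `R`-matrix in the gauge in which it has integral powers of `q`. -/
def cgR (n : ℕ) (q : ℂ) : Mat2 n :=
  orderDiag n q q q⁻¹ + (q - q⁻¹) • (orderDiag n 0 0 1 * swapMat n + insideComb n 1 1)

theorem orderDiag_mul_cgCore_mul_orderDiag {r : ℂ} (hr : r ≠ 0) :
    orderDiag n r 1 r⁻¹ * cgCore n r * orderDiag n r 1 r⁻¹ = cgR n (r ^ 2) := by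
  have hstd : orderDiag n r 1 r⁻¹ * stdR n (r ^ 2) * orderDiag n r 1 r⁻¹ =
      orderDiag n (r ^ 2) (r ^ 2) (r ^ 2)⁻¹ +
        (r ^ 2 - (r ^ 2)⁻¹) • (orderDiag n 0 0 1 * swapMat n) := by
    rw [stdR, mul_add, add_mul, orderDiag_mul, orderDiag_mul, ← mul_assoc, orderDiag_mul,
      mul_assoc _ (swapMat n), swapMat_mul_orderDiag, ← mul_assoc, orderDiag_mul,
      ← smul_mul_assoc, smul_orderDiag]
    congr 1
    · congr 1 <;> field_simp
    · congr 2
      · ring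
      · ring
      · field_simp
  have htilde : orderDiag n r 1 r⁻¹ * cgTilde n r * orderDiag n r 1 r⁻¹ = insideComb n 1 1 := by
    have hscalar : orderDiag n (r * 1) (1 * r) (r⁻¹ * r ^ 2) = r • 1 := by
      rw [← orderDiag_const]
      congr 1 <;> field_simp
    rw [cgTilde, ← mul_assoc, orderDiag_mul, mul_assoc, insideComb_mul_orderDiag, hscalar,
      smul_mul_assoc, one_mul, smul_insideComb]
    congr 1 <;> field_simp
  rw [cgCore, mul_add, add_mul, hstd, mul_smul_comm, smul_mul_assoc, htilde, cgR, smul_add,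
    add_assoc]

end CremmerGervaisCore

section SimpleRoots

variable {n : ℕ}

/-- The simple roots whose sum is the positive root `α`. -/
def simpleSupport (α : Fin n × Fin n) : Finset (Fin (n - 1)) :=
  {k | α.1.val ≤ k.val ∧ k.val < α.2.val}

theorem mem_simpleSupport {α : Fin n × Fin n} {k : Fin (n - 1)} :
    k ∈ simpleSupport α ↔ α.1.val ≤ k.val ∧ k.val < α.2.val := by
  simp only [simpleSupport, Finset.mem_filter, Finset.mem_univ, true_and]

theorem simpleSupport_nonempty {α : Fin n × Fin n} (hα : α.1 < α.2) :
    (simpleSupport α).Nonempty := by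
  rw [Fin.lt_def] at hα
  exact ⟨⟨α.1.val, by omega⟩, mem_simpleSupport.2 ⟨le_rfl, hα⟩⟩

theorem sum_simpleRoot_simpleSupport {α : Fin n × Fin n} (hα : α.1 < α.2) :
    ∑ k ∈ simpleSupport α, simpleRoot k = rootVec α := by
  let e : ℕ → Fin n → ℂ := fun k j => if j.val = k then 1 else 0
  have he : ∀ i : Fin n, e i.val = Pi.single i 1 := fun i => by
    ext j
    simp only [e, Pi.single_apply, Fin.ext_iff]
  have hroot : ∀ k : Fin (n - 1), simpleRoot k = e k.val - e (k.val + 1) := fun k => by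
    rw [simpleRoot, rootVec, ← he, ← he]
    rfl
  have hmap : (simpleSupport α).map Fin.valEmbedding = Finset.Ico α.1.val α.2.val := by
    ext k
    simp only [Finset.mem_map, mem_simpleSupport, Fin.valEmbedding_apply, Finset.mem_Ico]
    exact ⟨by rintro ⟨k, hk, rfl⟩; exact hk, fun hk => ⟨⟨k, by omega⟩, hk, rfl⟩⟩
  have htelescope := Finset.sum_Ico_sub e (Fin.lt_def.1 hα).le
  calc ∑ k ∈ simpleSupport α, simpleRoot k
      = ∑ k ∈ Finset.Ico α.1.val α.2.val, (e k - e (k + 1)) := by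
        simp only [← hmap, Finset.sum_map, hroot, Fin.valEmbedding_apply]
    _ = -∑ k ∈ Finset.Ico α.1.val α.2.val, (e (k + 1) - e k) := by
        simp only [← Finset.sum_neg_distrib, neg_sub]
    _ = rootVec α := by rw [htelescope, neg_sub, he, he, rootVec]

theorem linearIndependent_simpleRoot :
    LinearIndependent ℂ (simpleRoot : Fin (n - 1) → Fin n → ℂ) := by
  let partialSum : Fin (n - 1) → Module.Dual ℂ (Fin n → ℂ) := fun i =>
    ∑ j : Fin n with j.val ≤ i.val, LinearMap.proj j
  have hsingle : ∀ i (j : Fin n),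
      partialSum i (Pi.single j 1) = if j.val ≤ i.val then 1 else 0 := fun i j => by
    simp [partialSum, Pi.single_apply]
  have hroot : ∀ i k, partialSum i (simpleRoot k) = if i = k then 1 else 0 := fun i k => by
    rw [simpleRoot, rootVec, map_sub, hsingle, hsingle]
    have hval : i = k ↔ k.val ≤ i.val ∧ ¬k.val + 1 ≤ i.val := by rw [Fin.ext_iff]; omega
    by_cases h₁ : k.val ≤ i.val <;> by_cases h₂ : k.val + 1 ≤ i.val <;>
      first | omega | simp only [simplePair, hval, h₁, h₂]; norm_num
  refine .of_pairwise_dual_eq_zero_one _ partialSum (fun i k hik => ?_) fun i => ?_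
  · exact (hroot i k).trans (if_neg hik)
  · rw [hroot, if_pos rfl]

theorem sum_iverson_smul_simpleRoot_inj {p q : Fin (n - 1) → Prop} :
    ∑ k, iverson (p k) • simpleRoot k = ∑ k, iverson (q k) • simpleRoot k ↔ ∀ k, p k ↔ q k := by
  refine ⟨fun h k => ?_, fun h => by simp only [h]⟩
  have hcoeff := congrFun (linearIndependent_simpleRoot.fintypeLinearCombination_injective h) k
  by_cases hp : p k <;> by_cases hq : q k <;>
    simp_all [iverson_true, iverson_false]

theorem rootVec_eq_sum_iverson_smul {α : Fin n × Fin n} (hα : α.1 < α.2) :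
    rootVec α = ∑ k, iverson (k ∈ simpleSupport α) • simpleRoot k := by
  classical
  simp only [← sum_simpleRoot_simpleSupport hα, iverson, ite_smul, one_smul, zero_smul,
    Finset.sum_ite_mem, Finset.univ_inter]

end SimpleRoots

namespace BDTriple

variable {n : ℕ} (T : BDTriple n)

theorem step_iff {α β : Fin n × Fin n} :
    T.Step α β ↔ α.1 < α.2 ∧ β.1 < β.2 ∧ simpleSupport α ⊆ T.Γ₁ ∧ simpleSupport β ⊆ T.Γ₂ ∧
      ∀ k : T.Γ₁, k.1 ∈ simpleSupport α ↔ (T.τ k).1 ∈ simpleSupport β := by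
  have hsum : (∑ k : T.Γ₁, if α.1.val ≤ k.1.val ∧ k.1.val < α.2.val then simpleRoot (T.τ k).1
      else 0) = ∑ l, iverson (∃ h : l ∈ T.Γ₂, (T.τ.symm ⟨l, h⟩).1 ∈ simpleSupport α) •
        simpleRoot l := by
    calc _ = ∑ l : T.Γ₂, iverson (∃ h : l.1 ∈ T.Γ₂, (T.τ.symm ⟨l, h⟩).1 ∈ simpleSupport α) •
          simpleRoot l.1 := by
          rw [← Equiv.sum_comp T.τ]
          refine Finset.sum_congr rfl fun k _ => ?_
          simp [iverson, mem_simpleSupport]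
      _ = _ := by
          rw [Finset.sum_coe_sort T.Γ₂ fun l =>
            iverson (∃ h : l ∈ T.Γ₂, (T.τ.symm ⟨l, h⟩).1 ∈ simpleSupport α) • simpleRoot l]
          refine Finset.sum_subset (Finset.subset_univ _) fun l _ hl => ?_
          rw [iverson_false fun h => hl h.1, zero_smul]
  unfold Step
  rw [hsum]
  refine and_congr_right fun _ => and_congr_right fun hβ => ?_
  rw [rootVec_eq_sum_iverson_smul hβ, sum_iverson_smul_simpleRoot_inj]
  simp only [Finset.subset_iff, mem_simpleSupport (α := α), and_imp]
  refine and_congr_right fun _ => ⟨fun h => ⟨fun k hk => ((h k).2 hk).1, fun k => ?_⟩, ?_⟩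
  · rw [← h, exists_prop_of_true (T.τ k).2, Subtype.coe_eta, Equiv.symm_apply_apply]
  · rintro ⟨hβ₂, h⟩ k
    refine ⟨?_, fun hk => ⟨hβ₂ hk, ?_⟩⟩
    · rintro ⟨hk, hα⟩
      simpa using (h _).1 hα
    · rw [h]
      simpa using hk

end BDTriple

namespace BDTriple

section Order

variable {n : ℕ} {T : BDTriple n} {m : ℕ} {α β : Fin n × Fin n}

theorem pow_succ_iff_exists_pow :
    T.Pow (m + 1) α β ↔ ∃ γ, T.Pow m α γ ∧ T.Step γ β := by
  induction m generalizing α with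
  | zero => simp only [Pow, exists_eq_right, exists_eq_left']
  | succ m ih =>
    rw [Pow]
    simp only [ih]
    simp only [Pow]
    exact ⟨fun ⟨δ, hδ, γ, hγ, h⟩ => ⟨γ, ⟨δ, hδ, hγ⟩, h⟩,
      fun ⟨γ, ⟨δ, hδ, hγ⟩, h⟩ => ⟨δ, hδ, γ, hγ, h⟩⟩

theorem prec_iff : T.Prec α β ↔ ∃ m, T.Pow (m + 1) α β :=
  ⟨fun ⟨m, hm, h⟩ => ⟨m - 1, by rwa [Nat.sub_add_cancel hm]⟩, fun ⟨m, h⟩ => ⟨m + 1, by omega, h⟩⟩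

theorem Prec.left_lt (h : T.Prec α β) : α.1 < α.2 := by
  obtain ⟨m, γ, hγ, -⟩ := prec_iff.1 h
  exact hγ.1

theorem Prec.right_lt (h : T.Prec α β) : β.1 < β.2 := by
  obtain ⟨m, hm⟩ := prec_iff.1 h
  obtain ⟨γ, -, hγ⟩ := pow_succ_iff_exists_pow.1 hm
  exact hγ.2.1

theorem not_prec_self (α : Fin n × Fin n) : ¬T.Prec α α := by
  let periodic : Fin (n - 1) → Prop := fun k => ∃ γ, k ∈ simpleSupport γ ∧ T.Prec γ γ
  have hstable : ∀ k, periodic k → ∃ h : k ∈ T.Γ₁, periodic (T.τ ⟨k, h⟩).1 := by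
    rintro k ⟨γ, hk, hγ⟩
    obtain ⟨m, δ, hstep, hpow⟩ := prec_iff.1 hγ
    obtain ⟨-, -, hγ₁, -, hsupp⟩ := T.step_iff.1 hstep
    exact ⟨hγ₁ hk, δ, (hsupp ⟨k, hγ₁ hk⟩).1 hk,
      prec_iff.2 ⟨m, pow_succ_iff_exists_pow.2 ⟨γ, hpow, hstep⟩⟩⟩
  intro h
  obtain ⟨k, hk⟩ := simpleSupport_nonempty h.left_lt
  have hperiodic : periodic k := ⟨α, hk, h⟩
  obtain ⟨b, hb, hkb⟩ := T.nilpotent k (hstable k hperiodic).1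
  refine hb (hstable b ?_).1
  clear hb
  induction hkb with
  | single hstep =>
    obtain ⟨_, rfl⟩ := hstep
    exact (hstable k hperiodic).2
  | tail _ hstep ih =>
    obtain ⟨_, rfl⟩ := hstep
    exact (hstable _ ih).2

theorem inverse_step_iff : T.inverse.Step α β ↔ T.Step β α := by
  simp only [step_iff]
  refine ⟨fun ⟨hα, hβ, h₂, h₁, h⟩ => ⟨hβ, hα, h₁, h₂, fun k => ?_⟩,
    fun ⟨hβ, hα, h₁, h₂, h⟩ => ⟨hα, hβ, h₂, h₁, fun (k : T.Γ₂) => ?_⟩⟩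
  · have hk : (T.τ k).1 ∈ simpleSupport α ↔ (T.τ.symm (T.τ k)).1 ∈ simpleSupport β := h (T.τ k)
    rw [hk, Equiv.symm_apply_apply]
  · have hk := h (T.τ.symm k)
    rw [Equiv.apply_symm_apply] at hk
    exact hk.symm

theorem inverse_pow_iff : T.inverse.Pow m α β ↔ T.Pow m β α := by
  induction m generalizing α with
  | zero => exact eq_comm
  | succ m ih =>
    rw [pow_succ_iff_exists_pow (T := T), Pow]
    simp only [ih, inverse_step_iff, and_comm]

theorem inverse_prec_iff : T.inverse.Prec α β ↔ T.Prec β α := by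
  simp only [Prec, inverse_pow_iff]

end Order

section Entries

variable {n : ℕ} (T : BDTriple n)

theorem AMat_apply (m : ℕ) (ħ : ℂ) (u v : Fin n × Fin n) :
    T.AMat m ħ u v = qdiff ħ * (iverson (T.Pow m (v.2, u.2) (u.1, v.1)) *
      T.sign (v.2, u.2) (u.1, v.1) * qpow ħ (T.K (v.2, u.2) (u.1, v.1))) := by
  rw [AMat, Matrix.smul_apply, smul_eq_mul, sum_smul_eMat_kronecker_eMat_swap_apply
    fun α β => iverson (T.Pow m α β) * T.sign α β * qpow ħ (T.K α β)]

theorem aMat_apply (u v : Fin n × Fin n) :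
    T.aMat u v =
      iverson (T.Prec (v.1, u.1) (u.2, v.2)) * T.sign (v.1, u.1) (u.2, v.2) -
        iverson (T.Prec (v.2, u.2) (u.1, v.1)) * T.sign (v.2, u.2) (u.1, v.1) := by
  simp only [aMat, wedge, smul_sub, Finset.sum_sub_distrib, Matrix.sub_apply]
  rw [sum_smul_eMat_kronecker_eMat_swap_apply fun α β => iverson (T.Prec α β) * T.sign α β,
    sum_smul_eMat_swap_kronecker_eMat_apply fun α β => iverson (T.Prec α β) * T.sign α β]

theorem aMat_apply_self (u : Fin n × Fin n) : T.aMat u u = 0 := by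
  rw [aMat_apply, iverson_false fun h => h.left_lt.false, iverson_false fun h => h.left_lt.false,
    zero_mul, zero_mul, sub_zero]

theorem aMat_apply_swap (u : Fin n × Fin n) : T.aMat u u.swap = 0 := by
  rw [aMat_apply]
  simp only [Prod.fst_swap, Prod.snd_swap, iverson_false (not_prec_self _), zero_mul, sub_zero]

end Entries

section Inverse

variable {n : ℕ} {T : BDTriple n}

theorem IsR0.transpose_of_inverse {s : Matrix (Fin n) (Fin n) ℂ} (hs : T.inverse.IsR0 s) :
    T.IsR0 sᵀ := by
  obtain ⟨hanti, hroot⟩ := hs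
  refine ⟨by rw [transpose_transpose, hanti, neg_neg], fun k => ?_⟩
  have hk : (simpleRoot (T.τ k).1 - simpleRoot (T.τ.symm (T.τ k)).1) ᵥ* s =
      (1 / 2 : ℂ) • (simpleRoot (T.τ k).1 + simpleRoot (T.τ.symm (T.τ k)).1) := hroot (T.τ k)
  rw [Equiv.symm_apply_apply] at hk
  rw [hanti, vecMul_neg, ← neg_vecMul, neg_sub, hk, add_comm]

theorem inverse_aMat (hsign : ∀ α β, T.inverse.sign β α = T.sign α β) :
    T.inverse.aMat = antiflip T.aMat := by
  ext u v
  simp only [antiflip_apply, aMat_apply, inverse_prec_iff, hsign, Prod.fst_swap, Prod.snd_swap]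

theorem inverse_epsMat (ha : T.inverse.aMat = antiflip T.aMat) :
    T.inverse.epsMat = antiflip T.epsMat := by
  rw [epsMat, epsMat, ha, antiflip_add, antiflip_add, antiflip_mul, antiflip_mul, antiflip_mul,
    antiflip_rStd, add_comm (rStd n * _)]

theorem inverse_RGGS (ha : T.inverse.aMat = antiflip T.aMat) (s : Matrix (Fin n) (Fin n) ℂ)
    (ħ : ℂ) : T.inverse.RGGS s ħ = antiflip (T.RGGS sᵀ ħ) := by
  have htilde : T.inverse.aTilde ħ = antiflip (T.aTilde ħ) := by
    ext u v
    simp only [aTilde, of_apply, antiflip_apply, ha, inverse_epsMat ha]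
  rw [RGGS, RGGS, htilde, antiflip_mul, antiflip_mul, antiflip_add, antiflip_smul, antiflip_RStd,
    antiflip_qpowRZero, transpose_transpose, mul_assoc]

theorem inverse_AMat {m : ℕ} (ħ : ℂ) (hsign : ∀ α β, T.inverse.sign β α = T.sign α β)
    (hK : ∀ α β, T.Pow m α β → T.inverse.K β α = -T.K α β) :
    T.inverse.AMat m ħ = -antiflip (T.AMat m (-ħ)) := by
  ext u v
  rw [Matrix.neg_apply, antiflip_apply, AMat_apply, AMat_apply, qdiff_neg, neg_mul, neg_neg]
  simp only [inverse_pow_iff, hsign, Prod.fst_swap, Prod.snd_swap]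
  by_cases h : T.Pow m (u.1, v.1) (v.2, u.2)
  · rw [hK _ _ h, qpow_neg, qpow_neg_left]
  · simp only [iverson_false h, zero_mul]

theorem inverse_JMat {ħ : ℂ}
    (hA : ∀ m, T.inverse.AMat (m + 1) ħ = -antiflip (T.AMat (m + 1) (-ħ)))
    (hsq : ∀ m, T.AMat (m + 1) (-ħ) * T.AMat (m + 1) (-ħ) = 0) :
    T.inverse.JMat ħ = antiflip (T.JMat (-ħ))⁻¹ := by
  have hfactor : ∀ m, 1 + T.inverse.AMat (m + 1) ħ =
      antiflip (1 + T.AMat (m + 1) (-ħ))⁻¹ := fun m => by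
    have hinv : (1 + T.AMat (m + 1) (-ħ))⁻¹ = 1 + -T.AMat (m + 1) (-ħ) :=
      inv_eq_right_inv (by rw [add_mul, one_mul, mul_add, mul_one, mul_neg, hsq]; abel)
    rw [hinv, hA, antiflip_add, antiflip_one, antiflip_neg]
  rw [JMat, JMat]
  induction List.range n with
  | nil => simp only [List.map_nil, List.prod_nil, inv_one, antiflip_one]
  | cons m l ih =>
    rw [List.map_cons, List.prod_cons, List.map_cons, List.prod_cons, ih, hfactor,
      Matrix.mul_inv_rev, antiflip_mul]

theorem inverse_RJ {ħ : ℂ} (hJ : T.inverse.JMat ħ = antiflip (T.JMat (-ħ))⁻¹)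
    (hunit : IsUnit (T.JMat (-ħ)).det) (s : Matrix (Fin n) (Fin n) ℂ) :
    T.inverse.RJ s ħ = antiflip (T.RJ sᵀ (-ħ))⁻¹ := by
  have hQ : antiflip (qpowRZero sᵀ (-ħ))⁻¹ = qpowRZero s ħ := by
    rw [antiflip_inv, antiflip_qpowRZero, transpose_transpose]
    exact inv_eq_left_inv (qpowRZero_mul_qpowRZero_neg s ħ)
  have hR : antiflip (RStd n (-ħ))⁻¹ = RStd n ħ := by
    rw [antiflip_inv, antiflip_RStd]
    exact inv_eq_left_inv (RStd_mul_RStd_neg ħ)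
  simp only [RJ, Matrix.mul_inv_rev, antiflip_mul, hQ, hR, hJ, ← antiflip_inv,
    nonsing_inv_nonsing_inv _ hunit, ← flip21_inv, antiflip_flip21, mul_assoc]

end Inverse

end BDTriple

section Jets

theorem eq_zero_of_pow_mul_isBigO {g : ℂ → ℂ} (hg : Continuous g) {k l : ℕ} (hkl : k < l)
    (h : (fun ħ : ℂ => ħ ^ k * g ħ) =O[nhds 0] fun ħ => ħ ^ l) : g 0 = 0 := by
  obtain ⟨C, hC⟩ := h.bound
  have hle : ∀ᶠ ħ : ℂ in nhdsWithin 0 {0}ᶜ, ‖g ħ‖ ≤ C * ‖ħ‖ ^ (l - k) := by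
    filter_upwards [hC.filter_mono nhdsWithin_le_nhds, self_mem_nhdsWithin] with ħ hħ hne
    have hpos : 0 < ‖ħ‖ ^ k := pow_pos (norm_pos_iff.2 hne) k
    rw [norm_mul, norm_pow, norm_pow, ← pow_mul_pow_sub _ hkl.le] at hħ
    exact le_of_mul_le_mul_left (by linarith) hpos
  have hright : Filter.Tendsto (fun ħ : ℂ => C * ‖ħ‖ ^ (l - k)) (nhds 0) (nhds 0) :=
    Continuous.tendsto' (by fun_prop) _ _ (by simp [Nat.sub_ne_zero_of_lt hkl])
  exact norm_le_zero_iff.1 (le_of_tendsto_of_tendsto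
    (hg.norm.continuousAt.mono_left nhdsWithin_le_nhds)
    (hright.mono_left nhdsWithin_le_nhds) hle)

/-- `f ≡ c₀ + c₁ ħ + c₂ ħ² (mod ħ³)` -/
def HasJet (f : ℂ → ℂ) (c₀ c₁ c₂ : ℂ) : Prop :=
  (fun ħ => f ħ - (c₀ + c₁ * ħ + c₂ * ħ ^ 2)) =O[nhds 0] fun ħ => ħ ^ 3

variable {f g : ℂ → ℂ} {c₀ c₁ c₂ d₀ d₁ d₂ : ℂ}

theorem HasJet.congr_coeff (h : HasJet f c₀ c₁ c₂) (h₀ : c₀ = d₀) (h₁ : c₁ = d₁)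
    (h₂ : c₂ = d₂) : HasJet f d₀ d₁ d₂ := by
  subst h₀ h₁ h₂
  exact h

theorem HasJet.eq_zero_of_zero (h : HasJet 0 c₀ c₁ c₂) : c₀ = 0 ∧ c₁ = 0 ∧ c₂ = 0 := by
  have hneg : (fun ħ : ℂ => c₀ + c₁ * ħ + c₂ * ħ ^ 2) =O[nhds 0] fun ħ => ħ ^ 3 :=
    (IsBigO.neg_left h).congr_left fun ħ => by simp only [Pi.zero_apply]; ring
  have h₀ : c₀ = 0 := by
    simpa using eq_zero_of_pow_mul_isBigO (g := fun ħ => c₀ + (c₁ + c₂ * ħ) * ħ) (k := 0)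
      (by fun_prop) (by norm_num) (hneg.congr_left fun ħ => by ring)
  have h₁ : c₁ = 0 := by
    simpa using eq_zero_of_pow_mul_isBigO (g := fun ħ => c₁ + c₂ * ħ) (k := 1)
      (by fun_prop) (by norm_num) (hneg.congr_left fun ħ => by rw [h₀]; ring)
  have h₂ : c₂ = 0 :=
    eq_zero_of_pow_mul_isBigO (g := fun _ => c₂) (k := 2)
      (by fun_prop) (by norm_num) (hneg.congr_left fun ħ => by rw [h₀, h₁]; ring)
  exact ⟨h₀, h₁, h₂⟩

theorem HasJet.sub (h : HasJet f c₀ c₁ c₂) (h' : HasJet g d₀ d₁ d₂) :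
    HasJet (f - g) (c₀ - d₀) (c₁ - d₁) (c₂ - d₂) :=
  (IsBigO.sub h h').congr_left fun ħ => by simp only [Pi.sub_apply]; ring

theorem HasJet.unique (h : HasJet f c₀ c₁ c₂) (h' : HasJet f d₀ d₁ d₂) :
    c₀ = d₀ ∧ c₁ = d₁ ∧ c₂ = d₂ := by
  have hsub := h.sub h'
  rw [sub_self] at hsub
  simpa only [sub_eq_zero] using hsub.eq_zero_of_zero

theorem HasJet.mul (h : HasJet f c₀ c₁ c₂) (h' : HasJet g d₀ d₁ d₂) :
    HasJet (f * g) (c₀ * d₀) (c₀ * d₁ + c₁ * d₀) (c₀ * d₂ + c₁ * d₁ + c₂ * d₀) := by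
  have hbounded : ∀ {k : ℂ → ℂ}, Continuous k → k =O[nhds 0] fun _ => (1 : ℂ) := fun hk =>
    (hk.tendsto 0).isBigO_one ℂ
  have hg : g =O[nhds 0] fun _ => (1 : ℂ) := by
    have hpoly : (fun ħ : ℂ => d₀ + d₁ * ħ + d₂ * ħ ^ 2) =O[nhds 0] fun _ => (1 : ℂ) :=
      hbounded (by fun_prop)
    exact ((IsBigO.trans h' (hbounded (by fun_prop))).add hpoly).congr_left fun ħ => by ring
  have hleft := (IsBigO.mul h hg)
  have hright := IsBigO.mul (hbounded (k := fun ħ => c₀ + c₁ * ħ + c₂ * ħ ^ 2) (by fun_prop)) h'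
  have hrest := (isBigO_refl (fun ħ : ℂ => ħ ^ 3) (nhds 0)).mul
    (hbounded (k := fun ħ => c₁ * d₂ + c₂ * d₁ + c₂ * d₂ * ħ) (by fun_prop))
  simp only [mul_one, one_mul] at hleft hright hrest
  exact ((hleft.add hright).add hrest).congr_left fun ħ => by simp only [Pi.mul_apply]; ring

theorem hasJet_const (c : ℂ) : HasJet (fun _ => c) c 0 0 :=
  (isBigO_zero _ _).congr_left fun ħ => by ring

theorem hasJet_qpow (y : ℂ) : HasJet (fun ħ => qpow ħ y) 1 y (y ^ 2 / 2) := by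
  have hzero : Filter.Tendsto (fun ħ : ℂ => ħ * y) (nhds 0) (nhds 0) :=
    Continuous.tendsto' (by fun_prop) _ _ (zero_mul y)
  have hcube : (fun ħ : ℂ => (ħ * y) ^ 3) =O[nhds 0] fun ħ => ħ ^ 3 :=
    ((isBigO_refl (fun ħ : ℂ => ħ ^ 3) (nhds 0)).const_mul_left (y ^ 3)).congr_left
      fun ħ => by ring
  refine (((Complex.exp_sub_sum_range_isBigO_pow 3).comp_tendsto hzero).trans hcube).congr_left
    fun ħ => ?_
  simp only [Function.comp, Finset.sum_range_succ, Finset.sum_range_zero, qpow]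
  norm_num
  ring

theorem hasJet_qdiff : HasJet qdiff 0 2 0 := by
  have hdiff : qdiff = (fun ħ => qpow ħ 1) - fun ħ => qpow ħ (-1) := by
    ext ħ
    simp only [qdiff, qpow, Pi.sub_apply, mul_one, mul_neg_one]
  rw [hdiff]
  exact ((hasJet_qpow 1).sub (hasJet_qpow (-1))).congr_coeff
    (by norm_num) (by norm_num) (by norm_num)

theorem hasJet_mul_qpow (x y : ℂ) :
    HasJet (fun ħ => x * qpow ħ y) x (x * y) (x * y ^ 2 / 2) :=
  ((hasJet_const x).mul (hasJet_qpow y)).congr_coeff (by ring) (by ring) (by ring)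

theorem hasJet_mul_qpow_mul_qdiff (x y : ℂ) :
    HasJet (fun ħ => x * qpow ħ y * qdiff ħ) 0 (2 * x) (2 * x * y) :=
  ((hasJet_mul_qpow x y).mul hasJet_qdiff).congr_coeff (by ring) (by ring) (by ring)

/-- `f` has the form `x q^y (q - q⁻¹)^z` with `z ∈ {0, 1}`. -/
def IsForm (f : ℂ → ℂ) : Prop :=
  ∃ x y : ℂ, ∃ z : ℕ, (z = 0 ∨ z = 1) ∧ ∀ ħ, f ħ = x * qpow ħ y * qdiff ħ ^ z

theorem isForm_mul_qpow (x y : ℂ) : IsForm fun ħ => x * qpow ħ y :=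
  ⟨x, y, 0, Or.inl rfl, fun ħ => by rw [pow_zero, mul_one]⟩

theorem isForm_mul_qpow_mul_qdiff (x y : ℂ) : IsForm fun ħ => x * qpow ħ y * qdiff ħ :=
  ⟨x, y, 1, Or.inr rfl, fun ħ => by rw [pow_one]⟩

theorem isForm_iff : IsForm f ↔
    ∃ x y : ℂ, (f = fun ħ => x * qpow ħ y) ∨ f = fun ħ => x * qpow ħ y * qdiff ħ := by
  constructor
  · rintro ⟨x, y, z, rfl | rfl, hf⟩
    · exact ⟨x, y, Or.inl (funext fun ħ => by rw [hf, pow_zero, mul_one])⟩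
    · exact ⟨x, y, Or.inr (funext fun ħ => by rw [hf, pow_one])⟩
  · rintro ⟨x, y, rfl | rfl⟩
    · exact isForm_mul_qpow x y
    · exact isForm_mul_qpow_mul_qdiff x y

theorem mul_qpow_congr {x x' y y' : ℂ} (hx : x = x') (hxy : x * y = x' * y') (ħ : ℂ) :
    x * qpow ħ y = x' * qpow ħ y' := by
  subst hx
  rcases eq_or_ne x 0 with rfl | hx
  · rw [zero_mul, zero_mul]
  · rw [mul_left_cancel₀ hx hxy]

theorem eq_zero_of_hasJet {x y x' y' : ℂ} (h : HasJet (fun ħ => x * qpow ħ y) c₀ c₁ c₂)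
    (h' : HasJet (fun ħ => x' * qpow ħ y' * qdiff ħ) c₀ c₁ c₂) : x = 0 ∧ x' = 0 := by
  obtain ⟨h₀, h₁, -⟩ := h.unique (hasJet_mul_qpow x y)
  obtain ⟨h₀', h₁', -⟩ := h'.unique (hasJet_mul_qpow_mul_qdiff x' y')
  have hx : x = 0 := h₀.symm.trans h₀'
  rw [hx, zero_mul] at h₁
  exact ⟨hx, (mul_eq_zero_iff_left two_ne_zero).1 (h₁'.symm.trans h₁)⟩

theorem IsForm.eq_of_hasJet (hf : IsForm f) (hg : IsForm g)
    (jf : HasJet f c₀ c₁ c₂) (jg : HasJet g c₀ c₁ c₂) : f = g := by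
  obtain ⟨x, y, rfl | rfl⟩ := isForm_iff.1 hf <;> obtain ⟨x', y', rfl | rfl⟩ := isForm_iff.1 hg
  · obtain ⟨hx, hxy, -⟩ := jf.unique (hasJet_mul_qpow x y)
    obtain ⟨hx', hxy', -⟩ := jg.unique (hasJet_mul_qpow x' y')
    exact funext (mul_qpow_congr (hx.symm.trans hx') (hxy.symm.trans hxy'))
  · obtain ⟨hx, hx'⟩ := eq_zero_of_hasJet jf jg
    simp only [hx, hx', zero_mul]
  · obtain ⟨hx', hx⟩ := eq_zero_of_hasJet jg jf
    simp only [hx, hx', zero_mul]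
  · obtain ⟨-, hx, hxy⟩ := jf.unique (hasJet_mul_qpow_mul_qdiff x y)
    obtain ⟨-, hx', hxy'⟩ := jg.unique (hasJet_mul_qpow_mul_qdiff x' y')
    have hxx' : x = x' := mul_left_cancel₀ two_ne_zero (hx.symm.trans hx')
    have hyy' : x * y = x' * y' := mul_left_cancel₀ (two_ne_zero (α := ℂ)) (by
      rw [← mul_assoc, ← mul_assoc, ← hxy, ← hxy'])
    exact funext fun ħ => by rw [mul_qpow_congr hxx' hyy' ħ]

end Jets

namespace BDTriple

section GGSMatrix

variable {n : ℕ} {T : BDTriple n} {s : Matrix (Fin n) (Fin n) ℂ}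

theorem isGGS_iff (R : ℂ → Mat2 n) :
    T.IsGGS s R ↔ ∀ u v, IsForm (fun ħ => R ħ u v) ∧
      HasJet (fun ħ => R ħ u v) ((1 : Mat2 n) u v) (2 * T.rMat s u v)
        (2 * (T.rMat s * T.rMat s) u v) := by
  have hentry : ∀ (u v : Fin n × Fin n) (ħ : ℂ),
      (1 + (2 * ħ) • T.rMat s + (2 * ħ ^ 2) • (T.rMat s * T.rMat s) : Mat2 n) u v =
        (1 : Mat2 n) u v + 2 * T.rMat s u v * ħ + 2 * (T.rMat s * T.rMat s) u v * ħ ^ 2 := by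
    intro u v ħ
    simp only [Matrix.add_apply, Matrix.smul_apply, smul_eq_mul]
    ring
  simp only [IsGGS, IsForm, HasJet, hentry, forall_and]

theorem IsGGS.eq {R R' : ℂ → Mat2 n} (h : T.IsGGS s R) (h' : T.IsGGS s R') : R = R' := by
  rw [isGGS_iff] at h h'
  ext ħ u v
  exact congrFun ((h u v).1.eq_of_hasJet (h' u v).1 (h u v).2 (h' u v).2) ħ

variable (T) in
theorem aMat_add_rStd_mul_self :
    (T.aMat + rStd n) * (T.aMat + rStd n) = T.epsMat + orderDiag n 0 (1 / 4) 0 := by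
  rw [← rStd_mul_rStd, epsMat]
  noncomm_ring

theorem rMat_apply_self (u : Fin n × Fin n) :
    T.rMat s u u = s u.1 u.2 + byOrder 0 (1 / 2) 0 u := by
  rw [rMat, Matrix.add_apply, Matrix.add_apply, aMat_apply_self, rStd_apply_self, rZero,
    diagonal_apply_eq, add_zero]

theorem rMat_apply_of_ne {u v : Fin n × Fin n} (h : u ≠ v) :
    T.rMat s u v = (T.aMat + rStd n) u v := by
  rw [rMat, add_assoc, Matrix.add_apply, rZero, diagonal_apply_ne _ h, zero_add]

theorem rMat_mul_rMat_apply (u v : Fin n × Fin n) :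
    (T.rMat s * T.rMat s) u v = (if u = v then s u.1 u.2 ^ 2 else 0) +
      (s u.1 u.2 + s v.1 v.2) * (T.aMat + rStd n) u v + T.epsMat u v +
        if u = v then byOrder 0 (1 / 4) 0 u else 0 := by
  rw [rMat, add_assoc, add_mul, mul_add, mul_add (T.aMat + rStd n), aMat_add_rStd_mul_self, rZero,
    diagonal_mul_diagonal, Matrix.add_apply, Matrix.add_apply, Matrix.add_apply, Matrix.add_apply,
    diagonal_mul, mul_diagonal, diagonal_apply, orderDiag_apply]
  simp only [← pow_two]
  ring

theorem RGGS_apply (ħ : ℂ) (u v : Fin n × Fin n) :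
    T.RGGS s ħ u v = (RStd n ħ + qdiff ħ • T.aTilde ħ) u v * qpow ħ (s u.1 u.2 + s v.1 v.2) := by
  rw [RGGS, qpowRZero, mul_diagonal, diagonal_mul, qpow_add]
  ring

theorem RGGS_apply_self (ħ : ℂ) (u : Fin n × Fin n) :
    T.RGGS s ħ u u = 1 * qpow ħ (byOrder 0 1 0 u + (s u.1 u.2 + s u.1 u.2)) := by
  rw [RGGS_apply, Matrix.add_apply, RStd_apply_self, Matrix.smul_apply, aTilde, of_apply,
    aMat_apply_self, zero_mul, smul_zero, add_zero, one_mul, qpow_add ħ (byOrder 0 1 0 u)]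

theorem epsMat_apply_self (heps : ∀ u v, T.aMat u v ^ 2 * T.epsMat u v = T.epsMat u v)
    (u : Fin n × Fin n) : T.epsMat u u = 0 := by
  rw [← heps, aMat_apply_self, sq, zero_mul, zero_mul]

theorem aMat_eq_zero_or_rStd_eq_zero {u v : Fin n × Fin n} (h : u ≠ v) :
    T.aMat u v = 0 ∨ rStd n u v = 0 := by
  rcases eq_or_ne u v.swap with rfl | huv
  · exact Or.inl (by simpa using aMat_apply_swap T v.swap)
  · exact Or.inr (by rw [rStd_apply_of_ne h, if_neg huv])

theorem RGGS_apply_of_ne (heps : ∀ u v, T.aMat u v ^ 2 * T.epsMat u v = T.epsMat u v)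
    {u v : Fin n × Fin n} (h : u ≠ v) (ħ : ℂ) :
    T.RGGS s ħ u v = (T.aMat + rStd n) u v *
      qpow ħ ((T.aMat + rStd n) u v * T.epsMat u v + (s u.1 u.2 + s v.1 v.2)) * qdiff ħ := by
  rw [RGGS_apply, Matrix.add_apply, Matrix.add_apply, RStd_apply_of_ne ħ h, Matrix.smul_apply,
    aTilde, of_apply, smul_eq_mul, qpow_add ħ _ (s u.1 u.2 + s v.1 v.2)]
  rcases aMat_eq_zero_or_rStd_eq_zero (T := T) h with ha | hr
  · have hε : T.epsMat u v = 0 := by rw [← heps, ha, sq, zero_mul, zero_mul]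
    simp only [ha, hε, mul_zero, qpow_zero]
    ring
  · rw [hr, add_zero]
    ring

theorem isGGS_RGGS (heps : ∀ u v, T.aMat u v ^ 2 * T.epsMat u v = T.epsMat u v) :
    T.IsGGS s (T.RGGS s) := by
  rw [isGGS_iff]
  intro u v
  rcases eq_or_ne u v with rfl | huv
  · have hsq : byOrder 0 (1 / 4) 0 u = byOrder 0 (1 / 2) 0 u ^ 2 := by
      rw [map_byOrder (· ^ 2)]
      norm_num
    have hdouble : byOrder 0 1 0 u = 2 * byOrder 0 (1 / 2) 0 u := by
      rw [map_byOrder (2 * ·)]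
      norm_num
    simp only [RGGS_apply_self]
    refine ⟨isForm_mul_qpow _ _, (hasJet_mul_qpow _ _).congr_coeff ?_ ?_ ?_⟩
    · rw [one_apply_eq]
    · rw [rMat_apply_self, hdouble]
      ring
    · rw [rMat_mul_rMat_apply, if_pos rfl, if_pos rfl, Matrix.add_apply, aMat_apply_self,
        rStd_apply_self, epsMat_apply_self heps, hdouble, hsq]
      ring
  · have hsq : (T.aMat + rStd n) u v ^ 2 * T.epsMat u v = T.epsMat u v := by
      rw [Matrix.add_apply]
      rcases aMat_eq_zero_or_rStd_eq_zero (T := T) huv with ha | hr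
      · rw [← heps, ha]
        ring
      · rw [hr, add_zero, heps]
    simp only [RGGS_apply_of_ne heps huv]
    refine ⟨isForm_mul_qpow_mul_qdiff _ _,
      (hasJet_mul_qpow_mul_qdiff _ _).congr_coeff ?_ ?_ ?_⟩
    · rw [one_apply_ne huv]
    · rw [rMat_apply_of_ne huv]
    · rw [rMat_mul_rMat_apply, if_neg huv, if_neg huv]
      linear_combination 2 * hsq

end GGSMatrix

section CremmerGervaisOrder

variable {n m : ℕ} {α β : Fin n × Fin n}

theorem cremmerGervais_step_iff :
    (cremmerGervais n).Step α β ↔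
      α.1 < α.2 ∧ β.1.val = α.1.val + 1 ∧ β.2.val = α.2.val + 1 := by
  have hα₂ := α.2.isLt
  have hβ₂ := β.2.isLt
  have hτ : ∀ k : (cremmerGervais n).Γ₁, ((cremmerGervais n).τ k).1.val = k.1.val + 1 :=
    fun _ => rfl
  have hΓ₁ : ∀ k, k ∈ (cremmerGervais n).Γ₁ ↔ k.val + 1 < n - 1 := fun k => by
    simp [cremmerGervais]
  have hΓ₂ : ∀ k, k ∈ (cremmerGervais n).Γ₂ ↔ 0 < k.val := fun k => by simp [cremmerGervais]
  simp only [step_iff, Finset.subset_iff, mem_simpleSupport, hτ, hΓ₁, hΓ₂, Fin.lt_def]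
  refine ⟨fun ⟨_, _, h₁, h₂, h⟩ => ?_, fun ⟨hα, _, _⟩ =>
    ⟨hα, by omega, fun _ => by omega, fun _ => by omega, fun _ => by omega⟩⟩
  have hsupp : ∀ k, k + 1 < n - 1 →
      (α.1.val ≤ k ∧ k < α.2.val ↔ β.1.val ≤ k + 1 ∧ k + 1 < β.2.val) := fun k hk =>
    h ⟨⟨k, by omega⟩, (hΓ₁ _).2 hk⟩
  have hα₁ := h₁ (x := ⟨α.2.val - 1, by omega⟩)
  have hβ₁ := h₂ (x := ⟨β.1.val, by omega⟩)
  simp only at hα₁ hβ₁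
  have ha := hsupp α.1.val (by omega)
  have hb := hsupp (α.2.val - 1) (by omega)
  have hc := hsupp (β.1.val - 1) (by omega)
  have hd := hsupp (β.2.val - 2) (by omega)
  omega

theorem cremmerGervais_pow_succ_iff :
    (cremmerGervais n).Pow (m + 1) α β ↔
      α.1 < α.2 ∧ β.1.val = α.1.val + (m + 1) ∧ β.2.val = α.2.val + (m + 1) := by
  induction m generalizing α with
  | zero => simp only [Pow, cremmerGervais_step_iff, exists_eq_right]
  | succ m ih =>
    rw [Pow]
    simp only [ih, cremmerGervais_step_iff, Fin.lt_def]
    refine ⟨fun ⟨γ, hαγ, _⟩ => by omega, fun h => ?_⟩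
    exact ⟨(⟨α.1.val + 1, by omega⟩, ⟨α.2.val + 1, by omega⟩), ⟨h.1, rfl, rfl⟩,
      by dsimp only; omega, by dsimp only; omega, by dsimp only; omega⟩

theorem cremmerGervais_prec_iff :
    (cremmerGervais n).Prec α β ↔
      α.1 < α.2 ∧ α.1 < β.1 ∧ α.2.val + β.1.val = α.1.val + β.2.val := by
  simp only [prec_iff, cremmerGervais_pow_succ_iff, Fin.lt_def]
  exact ⟨fun ⟨m, h⟩ => by omega, fun h => ⟨β.1.val - α.1.val - 1, by omega⟩⟩

theorem cremmerGervais_prec_iff_inside :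
    (cremmerGervais n).Prec α β ↔ Inside (α.2, β.1) (α.1, β.2) := by
  rw [cremmerGervais_prec_iff, Inside]
  tauto

theorem not_cremmerGervais_precRev : ¬(cremmerGervais n).PrecRev α β := by
  rintro ⟨hlen, _ | m, hm, hαβ, a, b, ha, hb, hab⟩
  · exact hm.not_gt zero_lt_one
  · rw [cremmerGervais_pow_succ_iff] at hαβ hab
    simp only [rootLen, simplePair] at hlen hab
    omega

theorem not_inverse_cremmerGervais_precRev : ¬(cremmerGervais n).inverse.PrecRev α β := by
  rintro ⟨hlen, _ | m, hm, hαβ, a, b, ha, hb, hab⟩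
  · exact hm.not_gt zero_lt_one
  · rw [inverse_pow_iff, cremmerGervais_pow_succ_iff] at hαβ hab
    simp only [rootLen, simplePair] at hlen hab
    omega

theorem cremmerGervais_sign : (cremmerGervais n).sign α β = 1 :=
  if_neg not_cremmerGervais_precRev

theorem inverse_cremmerGervais_sign : (cremmerGervais n).inverse.sign α β = 1 :=
  if_neg not_inverse_cremmerGervais_precRev

theorem not_lessdot_of_cremmerGervais_prec (h : (cremmerGervais n).Prec α β) :
    ¬Lessdot β α := by
  have hβ := h.right_lt
  rw [cremmerGervais_prec_iff] at h
  exact ((h.2.1.trans hβ).ne')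

theorem exists_between_lessdot_left_iff (h : (cremmerGervais n).Prec α β) :
    (∃ γ, (cremmerGervais n).Prec α γ ∧ (cremmerGervais n).Prec γ β ∧ Lessdot α γ) ↔
      α.2 < β.1 := by
  simp only [cremmerGervais_prec_iff, Lessdot, Fin.lt_def, Fin.ext_iff] at h ⊢
  refine ⟨fun ⟨γ, hγ⟩ => by omega, fun hlt => ⟨(α.2, ⟨2 * α.2.val - α.1.val, by omega⟩), ?_⟩⟩
  refine ⟨?_, ?_, rfl⟩ <;> dsimp only <;> omega

theorem exists_between_lessdot_right_iff (h : (cremmerGervais n).Prec α β) :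
    (∃ γ, (cremmerGervais n).Prec α γ ∧ (cremmerGervais n).Prec γ β ∧ Lessdot γ β) ↔
      α.2 < β.1 := by
  simp only [cremmerGervais_prec_iff, Lessdot, Fin.lt_def, Fin.ext_iff] at h ⊢
  refine ⟨fun ⟨γ, hγ⟩ => by omega,
    fun hlt => ⟨(⟨β.1.val + α.1.val - α.2.val, by omega⟩, β.1), ?_⟩⟩
  refine ⟨?_, ?_, rfl⟩ <;> dsimp only <;> omega

theorem half_mul_iverson_lessdot_add :
    1 / 2 * iverson (Lessdot α β) + iverson (α.2 < β.1) = byOrder 0 (1 / 2) 1 (β.1, α.2) := by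
  refine congrFun (eq_byOrder (f := fun u : Fin n × Fin n =>
    1 / 2 * iverson (u.2 = u.1) + iverson (u.2 < u.1)) (fun u h => ?_) (fun u h => ?_)
    fun u h => ?_) (β.1, α.2)
  · rw [iverson_false h.ne', iverson_false h.not_gt, mul_zero, add_zero]
  · rw [iverson_true h.symm, iverson_false h.not_gt, mul_one, add_zero]
  · rw [iverson_false h.ne, iverson_true h, mul_zero, zero_add]

theorem cremmerGervais_K (h : (cremmerGervais n).Prec α β) :
    (cremmerGervais n).K α β = byOrder 0 (1 / 2) 1 (β.1, α.2) := by
  have hadjacent : iverson (Lessdot β α ∧ (cremmerGervais n).Prec α β) = 0 :=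
    iverson_false fun h' => not_lessdot_of_cremmerGervais_prec h h'.1
  have hbetween : iverson (∃ γ, (cremmerGervais n).Prec α γ ∧ (cremmerGervais n).Prec γ β ∧
      Lessdot γ α) = 0 :=
    iverson_false fun ⟨_, hαγ, _, hγα⟩ => not_lessdot_of_cremmerGervais_prec hαγ hγα
  rw [K, hadjacent, hbetween, iverson_false not_cremmerGervais_precRev,
    ← half_mul_iverson_lessdot_add]
  simp only [h, and_true, exists_between_lessdot_left_iff h]
  ring

theorem inverse_cremmerGervais_K (h : (cremmerGervais n).Prec α β) :
    (cremmerGervais n).inverse.K β α = -(cremmerGervais n).K α β := by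
  have hadjacent : iverson (Lessdot β α ∧ (cremmerGervais n).Prec α β) = 0 :=
    iverson_false fun h' => not_lessdot_of_cremmerGervais_prec h h'.1
  have hbetween : iverson (∃ γ, (cremmerGervais n).Prec γ β ∧ (cremmerGervais n).Prec α γ ∧
      Lessdot β γ) = 0 :=
    iverson_false fun ⟨_, hγβ, _, hβγ⟩ => not_lessdot_of_cremmerGervais_prec hγβ hβγ
  have hright : (∃ γ, (cremmerGervais n).Prec γ β ∧ (cremmerGervais n).Prec α γ ∧
      Lessdot γ β) ↔ α.2 < β.1 := by
    simp only [and_left_comm, exists_between_lessdot_right_iff h]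
  rw [cremmerGervais_K h, ← half_mul_iverson_lessdot_add, K]
  simp only [inverse_prec_iff]
  rw [hadjacent, hbetween, hright, iverson_false not_inverse_cremmerGervais_precRev]
  simp only [h, and_true]
  ring

end CremmerGervaisOrder

end BDTriple

theorem prod_one_add_mul_one_sub_sum {R : Type*} [Ring R] {A : ℕ → R}
    (h : ∀ m m', m' ≤ m → A m * A m' = 0) (N : ℕ) :
    ((List.range N).map fun m => 1 + A m).prod * (1 - ∑ m ∈ Finset.range N, A m) = 1 := by
  induction N with
  | zero => simp only [List.range_zero, List.map_nil, List.prod_nil, Finset.range_zero,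
      Finset.sum_empty, sub_zero, mul_one]
  | succ N ih =>
    have hsum : A N * ∑ m ∈ Finset.range N, A m = 0 := by
      rw [Finset.mul_sum]
      exact Finset.sum_eq_zero fun m hm => h _ _ (Finset.mem_range.1 hm).le
    have hlast : (1 + A N) * (1 - (∑ m ∈ Finset.range N, A m + A N)) =
        1 - ∑ m ∈ Finset.range N, A m := by
      simp only [add_mul, one_mul, mul_sub, mul_one, mul_add, hsum, h N N le_rfl]
      abel
    rw [List.range_succ, List.map_append, List.prod_append, Finset.sum_range_succ, mul_assoc,
      List.map_singleton, List.prod_singleton, hlast, ih]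

theorem sum_iverson_eq_iverson_exists {N : ℕ} {P : ℕ → Prop} (hlt : ∀ m, P m → m < N)
    (hunique : ∀ m m', P m → P m' → m = m') :
    ∑ m ∈ Finset.range N, iverson (P m) = iverson (∃ m, P m) := by
  by_cases h : ∃ m, P m
  · rw [iverson_true h]
    obtain ⟨m, hm⟩ := h
    rw [Finset.sum_eq_single_of_mem m (Finset.mem_range.2 (hlt m hm))
      fun b _ hb => iverson_false fun hPb => hb (hunique b m hPb hm), iverson_true hm]
  · rw [iverson_false h]
    exact Finset.sum_eq_zero fun m _ => iverson_false fun hm => h ⟨m, hm⟩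

namespace BDTriple

section CremmerGervaisMatrices

variable {n : ℕ}

theorem cremmerGervais_aMat : (cremmerGervais n).aMat = insideComb n 1 1 := by
  ext u v
  rw [aMat_apply, cremmerGervais_sign, cremmerGervais_sign, insideComb_apply,
    cremmerGervais_prec_iff_inside, cremmerGervais_prec_iff_inside,
    ← inside_swap_left (v := v.swap)]
  simp only [mul_one, one_mul, Prod.swap]

theorem cremmerGervais_epsMat :
    (cremmerGervais n).epsMat =
      orderDiag n 0 (1 / 2) 1 * insideComb n 1 1 + insideComb n (-1) 0 := by
  have hright : insideComb n 1 1 * rStd n = insideComb n (-1) 0 := by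
    rw [rStd_eq, mul_add, ← mul_assoc, insideComb_mul_orderDiag, insideComb_mul_orderDiag,
      insideComb_mul_swapMat, insideComb_add]
    simp only [mul_zero, mul_one, neg_zero, zero_add]
  have hleft : rStd n * insideComb n 1 1 = orderDiag n 0 (1 / 2) 1 * insideComb n 1 1 := by
    rw [rStd_eq, add_mul, mul_assoc _ (swapMat n), swapMat_mul_insideComb, ← add_mul, orderDiag_add]
    simp only [zero_add, add_zero]
  rw [epsMat, cremmerGervais_aMat, insideComb_self_mul_insideComb, hright, hleft, add_zero,
    add_comm]

theorem cremmerGervais_aMat_sq_mul_epsMat (u v : Fin n × Fin n) :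
    (cremmerGervais n).aMat u v ^ 2 * (cremmerGervais n).epsMat u v =
      (cremmerGervais n).epsMat u v := by
  rw [cremmerGervais_epsMat, cremmerGervais_aMat, Matrix.add_apply, orderDiag, diagonal_mul]
  simp only [insideComb_apply]
  by_cases h : Inside u v
  · rw [iverson_true h, iverson_false h.not_swap]
    ring
  · by_cases h' : Inside u v.swap <;> simp only [h, h', iverson_true, iverson_false,
      not_false_eq_true] <;> ring

theorem cremmerGervais_aTilde (ħ : ℂ) :
    (cremmerGervais n).aTilde ħ = cgTilde n (qpow ħ (1 / 2)) := by
  have hq : byOrder 1 (qpow ħ (1 / 2)) (qpow ħ (1 / 2) ^ 2) =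
      fun u : Fin n × Fin n => qpow ħ (byOrder 0 (1 / 2) 1 u) := by
    ext u
    rw [map_byOrder (qpow ħ), qpow_zero, qpow_half_sq, qpow_one]
  ext u v
  rw [aTilde, of_apply, cremmerGervais_epsMat, cremmerGervais_aMat, cgTilde, orderDiag, orderDiag,
    hq, Matrix.add_apply, diagonal_mul, diagonal_mul, qpow_half_sq, ← qpow_one, ← qpow_neg]
  simp only [insideComb_apply]
  by_cases h : Inside u v
  · simp only [iverson_true h, iverson_false h.not_swap, mul_one, mul_zero, sub_zero, one_mul,
      qpow_add]
  · by_cases h' : Inside u v.swap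
    · simp only [iverson_true h', iverson_false h, mul_one, mul_zero, zero_sub, sub_zero, add_zero,
        mul_neg, neg_mul, one_mul, neg_neg]
    · simp only [iverson_false h, iverson_false h', mul_zero, sub_zero, zero_mul]

theorem cremmerGervais_RGGS (s : Matrix (Fin n) (Fin n) ℂ) (ħ : ℂ) :
    (cremmerGervais n).RGGS s ħ =
      qpowRZero s ħ * cgCore n (qpow ħ (1 / 2)) * qpowRZero s ħ := by
  rw [RGGS, RStd_eq, qdiff_eq, cremmerGervais_aTilde, ← qpow_half_sq, cgCore]

theorem cremmerGervais_RGGS_mul_neg (s : Matrix (Fin n) (Fin n) ℂ) (ħ : ℂ) :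
    (cremmerGervais n).RGGS s ħ * (cremmerGervais n).RGGS s (-ħ) = 1 := by
  have hcore : cgCore n (qpow ħ (1 / 2)) * cgCore n (qpow (-ħ) (1 / 2)) = 1 := by
    rw [qpow_neg_left, cgCore_mul_cgCore_inv (qpow_ne_zero _ _)]
  calc _ = qpowRZero s ħ * (cgCore n (qpow ħ (1 / 2)) * (qpowRZero s ħ * qpowRZero s (-ħ)) *
        cgCore n (qpow (-ħ) (1 / 2))) * qpowRZero s (-ħ) := by
        simp only [cremmerGervais_RGGS, mul_assoc]
    _ = 1 := by
        rw [qpowRZero_mul_qpowRZero_neg, mul_one, hcore, mul_one, qpowRZero_mul_qpowRZero_neg]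

theorem cremmerGervais_AMat_succ_apply (m : ℕ) (ħ : ℂ) (u v : Fin n × Fin n) :
    (cremmerGervais n).AMat (m + 1) ħ u v =
      qdiff ħ * (iverson ((cremmerGervais n).Pow (m + 1) (v.2, u.2) (u.1, v.1)) *
        qpow ħ (byOrder 0 (1 / 2) 1 u)) := by
  rw [AMat_apply, cremmerGervais_sign, mul_one]
  by_cases h : (cremmerGervais n).Pow (m + 1) (v.2, u.2) (u.1, v.1)
  · rw [cremmerGervais_K (prec_iff.2 ⟨m, h⟩)]
  · simp only [iverson_false h, zero_mul]

theorem cremmerGervais_AMat_mul_AMat (ħ : ℂ) {m m' : ℕ} (h : m' ≤ m) :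
    (cremmerGervais n).AMat (m + 1) ħ * (cremmerGervais n).AMat (m' + 1) ħ = 0 := by
  ext u v
  refine (Matrix.mul_apply ..).trans (Finset.sum_eq_zero fun p _ => ?_)
  rw [cremmerGervais_AMat_succ_apply, cremmerGervais_AMat_succ_apply]
  by_cases hup : (cremmerGervais n).Pow (m + 1) (p.2, u.2) (u.1, p.1)
  · have hpv : ¬(cremmerGervais n).Pow (m' + 1) (v.2, p.2) (p.1, v.1) := fun hpv => by
      simp only [cremmerGervais_pow_succ_iff, Fin.lt_def] at hup hpv
      omega
    simp only [iverson_false hpv, zero_mul, mul_zero]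
  · simp only [iverson_false hup, zero_mul, mul_zero]

theorem cremmerGervais_sum_AMat (ħ : ℂ) :
    ∑ m ∈ Finset.range n, (cremmerGervais n).AMat (m + 1) ħ = cgA n (qpow ħ (1 / 2)) := by
  ext u v
  have hsum : ∑ m ∈ Finset.range n,
      iverson ((cremmerGervais n).Pow (m + 1) (v.2, u.2) (u.1, v.1)) =
        iverson (Inside u v.swap) := by
    rw [sum_iverson_eq_iverson_exists, ← prec_iff, cremmerGervais_prec_iff_inside,
      ← inside_swap_left (v := v.swap)]
    · rfl
    all_goals
      simp only [cremmerGervais_pow_succ_iff]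
      omega
  have hq : qpow ħ (byOrder 0 (1 / 2) 1 u) =
      byOrder 1 (qpow ħ (1 / 2)) (qpow ħ (1 / 2) ^ 2) u := by
    rw [map_byOrder (qpow ħ), qpow_zero, qpow_half_sq, qpow_one]
  simp only [Matrix.sum_apply, cremmerGervais_AMat_succ_apply, ← Finset.mul_sum, ← Finset.sum_mul,
    hsum, hq]
  rw [cgA, Matrix.smul_apply, orderDiag, diagonal_mul, insideComb_apply, qdiff_eq, qpow_half_sq,
    smul_eq_mul]
  ring

theorem cremmerGervais_JMat_mul_one_sub (ħ : ℂ) :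
    (cremmerGervais n).JMat ħ * (1 - cgA n (qpow ħ (1 / 2))) = 1 := by
  rw [JMat, ← cremmerGervais_sum_AMat,
    prod_one_add_mul_one_sub_sum fun _ _ h => cremmerGervais_AMat_mul_AMat ħ h]

theorem cremmerGervais_RJ (s : Matrix (Fin n) (Fin n) ℂ) (ħ : ℂ) :
    (cremmerGervais n).RJ s ħ = (cremmerGervais n).RGGS s ħ := by
  have hJ := cremmerGervais_JMat_mul_one_sub (n := n) ħ
  have hJ₂₁ : (1 - flip21 (cgA n (qpow ħ (1 / 2)))) * flip21 ((cremmerGervais n).JMat ħ) = 1 :=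
    calc _ = flip21 ((1 - cgA n (qpow ħ (1 / 2))) * (cremmerGervais n).JMat ħ) := by
          rw [flip21_mul]
          exact congrArg (fun x => (x - flip21 _) * flip21 _) flip21_one.symm
      _ = 1 := by rw [mul_eq_one_comm.1 hJ, flip21_one]
  rw [cremmerGervais_RGGS, RJ, inv_eq_right_inv hJ, RStd_eq, ← qpow_half_sq,
    one_sub_cgA_mul_stdR (qpow_ne_zero _ _), mul_assoc (cgCore _ _), hJ₂₁, mul_one]

theorem inverse_cremmerGervais_sign_eq (α β : Fin n × Fin n) :
    (cremmerGervais n).inverse.sign β α = (cremmerGervais n).sign α β :=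
  inverse_cremmerGervais_sign.trans cremmerGervais_sign.symm

theorem inverse_cremmerGervais_RGGS (s : Matrix (Fin n) (Fin n) ℂ) (ħ : ℂ) :
    (cremmerGervais n).inverse.RGGS s ħ = antiflip ((cremmerGervais n).RGGS sᵀ ħ) :=
  inverse_RGGS (inverse_aMat inverse_cremmerGervais_sign_eq) s ħ

theorem inverse_cremmerGervais_aMat_sq_mul_epsMat (u v : Fin n × Fin n) :
    (cremmerGervais n).inverse.aMat u v ^ 2 * (cremmerGervais n).inverse.epsMat u v =
      (cremmerGervais n).inverse.epsMat u v := by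
  have ha := inverse_aMat (inverse_cremmerGervais_sign_eq (n := n))
  simp only [ha, inverse_epsMat ha, antiflip_apply, cremmerGervais_aMat_sq_mul_epsMat]

theorem inverse_cremmerGervais_RJ (s : Matrix (Fin n) (Fin n) ℂ) (ħ : ℂ) :
    (cremmerGervais n).inverse.RJ s ħ = (cremmerGervais n).inverse.RGGS s ħ := by
  have hA : ∀ m, (cremmerGervais n).inverse.AMat (m + 1) ħ =
      -antiflip ((cremmerGervais n).AMat (m + 1) (-ħ)) := fun m =>
    inverse_AMat ħ inverse_cremmerGervais_sign_eq fun _ _ h =>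
      inverse_cremmerGervais_K (prec_iff.2 ⟨m, h⟩)
  have hJ := inverse_JMat hA fun _ => cremmerGervais_AMat_mul_AMat (-ħ) le_rfl
  have hunit : IsUnit ((cremmerGervais n).JMat (-ħ)).det :=
    isUnit_det_of_right_inverse (cremmerGervais_JMat_mul_one_sub (-ħ))
  rw [inverse_RJ hJ hunit, cremmerGervais_RJ, inverse_cremmerGervais_RGGS,
    inv_eq_left_inv (cremmerGervais_RGGS_mul_neg sᵀ ħ)]

end CremmerGervaisMatrices

end BDTriple

section YangBaxter

variable {n : ℕ}

/-- The row vector of the monomials `a^x b^y`. -/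
def monRow₂ (n : ℕ) (a b : ℂ) : Fin n × Fin n → ℂ := fun u => a ^ u.1.val * b ^ u.2.val

/-- The row vector of the monomials `a^x b^y c^z`. -/
def monRow₃ (n : ℕ) (a b c : ℂ) : Fin n × Fin n × Fin n → ℂ :=
  fun u => a ^ u.1.val * b ^ u.2.1.val * c ^ u.2.2.val

theorem eq_zero_of_monRow₃_vecMul {κ : Type*} {X : Matrix (Fin n × Fin n × Fin n) κ ℂ}
    {f g h : Fin n → ℂ} (hf : f.Injective) (hg : g.Injective) (hh : h.Injective)
    (hX : ∀ i j k, monRow₃ n (f i) (g j) (h k) ᵥ* X = 0) : X = 0 := by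
  ext ⟨x, y, z⟩ w
  have hsum : ∀ i j k, ∑ x, (∑ y, (∑ z, X (x, y, z) w * h k ^ z.val) * g j ^ y.val) *
      f i ^ x.val = 0 := fun i j k => by
    refine Eq.trans ?_ (congrFun (hX i j k) w)
    simp only [vecMul, dotProduct, Fintype.sum_prod_type, monRow₃, Finset.sum_mul]
    exact Finset.sum_congr rfl fun x _ => Finset.sum_congr rfl fun y _ =>
      Finset.sum_congr rfl fun z _ => by ring
  have hx := fun j k => congrFun (eq_zero_of_forall_index_sum_mul_pow_eq_zero hf
    fun i => hsum i j k) x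
  have hy := fun k => congrFun (eq_zero_of_forall_index_sum_mul_pow_eq_zero hg
    fun j => hx j k) y
  exact congrFun (eq_zero_of_forall_index_sum_mul_pow_eq_zero hh hy) z

theorem monRow₃_vecMul_R12 (R : Mat2 n) (a b c : ℂ) :
    monRow₃ n a b c ᵥ* R12 R = fun w => (monRow₂ n a b ᵥ* R) (w.1, w.2.1) * c ^ w.2.2.val := by
  ext w
  simp only [vecMul, dotProduct, Fintype.sum_prod_type, monRow₃, monRow₂, R12, of_apply, mul_ite,
    mul_zero, Finset.sum_ite_eq', Finset.mem_univ, if_true, Finset.sum_mul]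
  exact Finset.sum_congr rfl fun _ _ => Finset.sum_congr rfl fun _ _ => by ring

theorem monRow₃_vecMul_R13 (R : Mat2 n) (a b c : ℂ) :
    monRow₃ n a b c ᵥ* R13 R = fun w => (monRow₂ n a c ᵥ* R) (w.1, w.2.2) * b ^ w.2.1.val := by
  ext w
  simp only [vecMul, dotProduct, Fintype.sum_prod_type_right, monRow₃, monRow₂, R13,
    of_apply, mul_ite, mul_zero, Finset.sum_ite_irrel, Finset.sum_const_zero, Finset.sum_ite_eq',
    Finset.mem_univ, if_true, Finset.sum_mul]
  exact Finset.sum_congr rfl fun _ _ => Finset.sum_congr rfl fun _ _ => by ring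

theorem monRow₃_vecMul_R23 (R : Mat2 n) (a b c : ℂ) :
    monRow₃ n a b c ᵥ* R23 R = fun w => (monRow₂ n b c ᵥ* R) (w.2.1, w.2.2) * a ^ w.1.val := by
  ext w
  simp only [vecMul, dotProduct, Fintype.sum_prod_type, monRow₃, monRow₂, R23, of_apply, mul_ite,
    mul_zero, Finset.sum_ite_irrel, Finset.sum_const_zero, Finset.sum_ite_eq', Finset.mem_univ,
    if_true, Finset.sum_mul]
  exact Finset.sum_congr rfl fun _ _ => Finset.sum_congr rfl fun _ _ => by ring

/-- The coefficient of the exchanged variables in the Demazure-Lusztig operator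
`f(a, b) ↦ (q - l a / (a - b)) f(a, b) + l a / (a - b) f(b, a)`. -/
def exchCoeff (l a b : ℂ) : ℂ := l * a / (a - b)

theorem exchCoeff_swap (l : ℂ) {a b : ℂ} (hab : a ≠ b) :
    exchCoeff l b a = l - exchCoeff l a b := by
  have := sub_ne_zero.2 hab
  have := sub_ne_zero.2 hab.symm
  rw [exchCoeff, exchCoeff]
  field_simp
  ring

theorem exchCoeff_braid (l : ℂ) {a b c : ℂ} (hab : a ≠ b) (hac : a ≠ c) (hbc : b ≠ c) :
    exchCoeff l a c * (l - exchCoeff l a b - exchCoeff l b c) +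
      exchCoeff l a b * exchCoeff l b c = 0 := by
  have := sub_ne_zero.2 hab
  have := sub_ne_zero.2 hac
  have := sub_ne_zero.2 hbc
  simp only [exchCoeff]
  field_simp
  ring

/-- `R` acts on polynomials in two variables as a Demazure-Lusztig operator. -/
def IsExchange (R : Mat2 n) (q l : ℂ) : Prop :=
  ∀ a b, a ≠ b → monRow₂ n a b ᵥ* R =
    (q - exchCoeff l a b) • monRow₂ n a b + exchCoeff l a b • monRow₂ n b a

section Exchange

variable {R : Mat2 n} {q l a b c : ℂ}

theorem IsExchange.monRow₃_vecMul_R12 (h : IsExchange R q l) (hab : a ≠ b) :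
    monRow₃ n a b c ᵥ* R12 R =
      (q - exchCoeff l a b) • monRow₃ n a b c + exchCoeff l a b • monRow₃ n b a c := by
  ext w
  rw [GGS.monRow₃_vecMul_R12, h a b hab]
  simp only [Pi.add_apply, Pi.smul_apply, smul_eq_mul, monRow₂, monRow₃]
  ring

theorem IsExchange.monRow₃_vecMul_R13 (h : IsExchange R q l) (hac : a ≠ c) :
    monRow₃ n a b c ᵥ* R13 R =
      (q - exchCoeff l a c) • monRow₃ n a b c + exchCoeff l a c • monRow₃ n c b a := by
  ext w
  rw [GGS.monRow₃_vecMul_R13, h a c hac]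
  simp only [Pi.add_apply, Pi.smul_apply, smul_eq_mul, monRow₂, monRow₃]
  ring

theorem IsExchange.monRow₃_vecMul_R23 (h : IsExchange R q l) (hbc : b ≠ c) :
    monRow₃ n a b c ᵥ* R23 R =
      (q - exchCoeff l b c) • monRow₃ n a b c + exchCoeff l b c • monRow₃ n a c b := by
  ext w
  rw [GGS.monRow₃_vecMul_R23, h b c hbc]
  simp only [Pi.add_apply, Pi.smul_apply, smul_eq_mul, monRow₂, monRow₃]
  ring

theorem IsExchange.monRow₃_vecMul_qybe (h : IsExchange R q l) (hab : a ≠ b) (hac : a ≠ c)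
    (hbc : b ≠ c) :
    monRow₃ n a b c ᵥ* (R12 R * R13 R * R23 R) = monRow₃ n a b c ᵥ* (R23 R * R13 R * R12 R) := by
  have hbraid := exchCoeff_braid l hab hac hbc
  simp only [← vecMul_vecMul, add_vecMul, smul_vecMul, h.monRow₃_vecMul_R12, h.monRow₃_vecMul_R13,
    h.monRow₃_vecMul_R23, hab, hac, hbc, hab.symm, hbc.symm, ne_eq, not_false_eq_true,
    exchCoeff_swap l hab, exchCoeff_swap l hbc]
  ext w
  simp only [Pi.add_apply, Pi.smul_apply, smul_eq_mul]
  linear_combination ((q - exchCoeff l a b) * monRow₃ n c a b w -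
    (q - exchCoeff l b c) * monRow₃ n b c a w +
    (exchCoeff l a b - exchCoeff l b c) * monRow₃ n c b a w) * hbraid

theorem IsExchange.qybe (h : IsExchange R q l) : QYBE R := by
  rw [QYBE, ← sub_eq_zero]
  let node : ℕ → Fin n → ℂ := fun r i => (3 * i.val + r : ℕ)
  have hinj : ∀ r, (node r).Injective := fun r i j hij => Fin.ext (by
    have := Nat.cast_injective hij
    omega)
  have hne : ∀ {r r'}, r < r' → r' < 3 → ∀ i j, node r i ≠ node r' j := fun hr hr' i j hij => by
    have := Nat.cast_injective hij
    omega
  refine eq_zero_of_monRow₃_vecMul (hinj 0) (hinj 1) (hinj 2) fun i j k => ?_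
  rw [vecMul_sub, sub_eq_zero]
  exact h.monRow₃_vecMul_qybe (hne (by omega) (by omega) _ _) (hne (by omega) (by omega) _ _)
    (hne (by omega) (by omega) _ _)

end Exchange

end YangBaxter

section Reversal

variable {n : ℕ}

/-- The permutation `(x, y, z) ↦ (z, y, x)`, which reverses the tensor factors of
`ℂⁿ ⊗ ℂⁿ ⊗ ℂⁿ`. -/
def tripleRev (n : ℕ) : Fin n × Fin n × Fin n ≃ Fin n × Fin n × Fin n where
  toFun u := (u.2.2, u.2.1, u.1)
  invFun u := (u.2.2, u.2.1, u.1)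
  left_inv _ := rfl
  right_inv _ := rfl

theorem R12_antiflip (R : Mat2 n) :
    R12 (antiflip R) = ((R23 R).submatrix (tripleRev n) (tripleRev n))ᵀ := by
  ext u v
  simp only [R12, R23, of_apply, transpose_apply, submatrix_apply, antiflip_apply, tripleRev,
    Equiv.coe_fn_mk, Prod.swap, eq_comm]

theorem R13_antiflip (R : Mat2 n) :
    R13 (antiflip R) = ((R13 R).submatrix (tripleRev n) (tripleRev n))ᵀ := by
  ext u v
  simp only [R13, of_apply, transpose_apply, submatrix_apply, antiflip_apply, tripleRev,
    Equiv.coe_fn_mk, Prod.swap, eq_comm]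

theorem R23_antiflip (R : Mat2 n) :
    R23 (antiflip R) = ((R12 R).submatrix (tripleRev n) (tripleRev n))ᵀ := by
  ext u v
  simp only [R12, R23, of_apply, transpose_apply, submatrix_apply, antiflip_apply, tripleRev,
    Equiv.coe_fn_mk, Prod.swap, eq_comm]

theorem QYBE.antiflip {R : Mat2 n} (h : QYBE R) : QYBE (antiflip R) := by
  rw [QYBE] at h ⊢
  rw [R12_antiflip, R13_antiflip, R23_antiflip]
  simp only [← transpose_mul, submatrix_mul_equiv]
  rw [← mul_assoc, ← mul_assoc, h]

end Reversal

section Twist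

variable {n : ℕ}

/-- `d ⊗ d` commutes with `R`, where `d` is a diagonal matrix. -/
def CommutesWithDiagonal (d : Fin n → ℂ) (R : Mat2 n) : Prop :=
  ∀ u v, R u v ≠ 0 → d u.1 * d u.2 = d v.1 * d v.2

/-- The twist `(1 ⊗ d) R (d⁻¹ ⊗ 1)` of `R` by a diagonal matrix `d`. -/
def twist (d : Fin n → ℂ) (R : Mat2 n) : Mat2 n :=
  of fun u v => d u.2 / d v.1 * R u v

variable {d : Fin n → ℂ} {R : Mat2 n}

theorem CommutesWithDiagonal.twist_R12_mul_R13_mul_R23 (h : CommutesWithDiagonal d R)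
    (hd : ∀ i, d i ≠ 0) (u v : Fin n × Fin n × Fin n) :
    (R12 (twist d R) * R13 (twist d R) * R23 (twist d R)) u v =
      d u.2.1 * d u.2.2 ^ 2 / (d v.1 ^ 2 * d v.2.1) * (R12 R * R13 R * R23 R) u v := by
  simp only [Matrix.mul_apply, Finset.sum_mul, Finset.mul_sum]
  refine Finset.sum_congr rfl fun w _ => Finset.sum_congr rfl fun x _ => ?_
  simp only [R12, R13, R23, twist, of_apply, ite_mul, mul_ite, mul_zero, zero_mul]
  refine ite_congr rfl (fun hwv => ite_congr rfl (fun _ => ite_congr rfl (fun hux => ?_)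
    fun _ => rfl) fun _ => rfl) fun _ => rfl
  by_cases hR : R (x.1, x.2.2) (w.1, w.2.2) = 0
  · simp only [hR, mul_zero, zero_mul]
  have hw : d w.2.2 = d x.1 * d x.2.2 / d w.1 := by
    rw [eq_div_iff (hd _), h _ _ hR, mul_comm]
  have hx := hd x.1
  have hv := hd v.1
  rw [hw, hux, hwv]
  field_simp

theorem CommutesWithDiagonal.twist_R23_mul_R13_mul_R12 (h : CommutesWithDiagonal d R)
    (hd : ∀ i, d i ≠ 0) (u v : Fin n × Fin n × Fin n) :
    (R23 (twist d R) * R13 (twist d R) * R12 (twist d R)) u v =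
      d u.2.1 * d u.2.2 ^ 2 / (d v.1 ^ 2 * d v.2.1) * (R23 R * R13 R * R12 R) u v := by
  simp only [Matrix.mul_apply, Finset.sum_mul, Finset.mul_sum]
  refine Finset.sum_congr rfl fun w _ => Finset.sum_congr rfl fun x _ => ?_
  simp only [R12, R13, R23, twist, of_apply, ite_mul, mul_ite, mul_zero, zero_mul]
  refine ite_congr rfl (fun _ => ite_congr rfl (fun hxw => ite_congr rfl (fun _ => ?_)
    fun _ => rfl) fun _ => rfl) fun _ => rfl
  by_cases hR : R (u.2.1, u.2.2) (x.2.1, x.2.2) = 0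
  · simp only [hR, mul_zero, zero_mul]
  by_cases hR' : R (w.1, w.2.1) (v.1, v.2.1) = 0
  · simp only [hR', mul_zero]
  have hu : d u.2.1 = d w.2.1 * d x.2.2 / d u.2.2 := by
    rw [eq_div_iff (hd _), ← hxw, h _ _ hR]
  have hv : d v.2.1 = d w.1 * d w.2.1 / d v.1 := by
    rw [eq_div_iff (hd _), h _ _ hR', mul_comm]
  have hu' := hd u.2.2
  have hv' := hd v.1
  have hw := hd w.2.1
  rw [hu, hv, hxw]
  field_simp

theorem QYBE.twist (hQ : QYBE R) (h : CommutesWithDiagonal d R) (hd : ∀ i, d i ≠ 0) :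
    QYBE (twist d R) := by
  ext u v
  rw [h.twist_R12_mul_R13_mul_R23 hd, h.twist_R23_mul_R13_mul_R12 hd, hQ]

theorem CommutesWithDiagonal.sq (h : CommutesWithDiagonal d R) :
    CommutesWithDiagonal (d ^ 2) R := fun u v huv => by
  simp only [Pi.pow_apply, ← mul_pow, h u v huv]

theorem CommutesWithDiagonal.diagonal_mul_mul_diagonal (h : CommutesWithDiagonal d R)
    (hd : ∀ i, d i ≠ 0) :
    (diagonal fun u => d u.2 / d u.1) * R * (diagonal fun u => d u.2 / d u.1) =
      twist (d ^ 2) R := by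
  ext u v
  rw [mul_diagonal, diagonal_mul, twist, of_apply, Pi.pow_apply, Pi.pow_apply]
  by_cases hR : R u v = 0
  · simp only [hR, mul_zero, zero_mul]
  have hu := hd u.1
  have hv := hd v.1
  field_simp
  linear_combination -(d u.2) * h u v hR

end Twist

section Exchange

variable {n : ℕ}

theorem sum_mul_iverson_inside (f : ℕ → ℕ → ℂ) (v : Fin n × Fin n) :
    ∑ u : Fin n × Fin n, f u.1 u.2 * iverson (Inside u v) =
      ∑ k ∈ Finset.Ico (v.1.val + 1) v.2.val, f k (v.1.val + v.2.val - k) := by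
  classical
  have hv := v.2.isLt
  simp only [iverson, mul_ite, mul_one, mul_zero, Inside, Fin.lt_def]
  rw [← Finset.sum_filter]
  refine Finset.sum_bij (fun u _ => u.1.val) (fun u hu => ?_) (fun u hu w hw huw => ?_)
    (fun k hk => ?_) (fun u hu => ?_)
  · rw [Finset.mem_filter] at hu
    rw [Finset.mem_Ico]
    omega
  · rw [Finset.mem_filter] at hu hw
    exact Prod.ext (Fin.ext huw) (Fin.ext (by omega))
  · rw [Finset.mem_Ico] at hk
    refine ⟨(⟨k, by omega⟩, ⟨v.1.val + v.2.val - k, by omega⟩), Finset.mem_filter.2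
      ⟨Finset.mem_univ _, ?_⟩, rfl⟩
    dsimp only
    omega
  · rw [Finset.mem_filter] at hu
    rw [show v.1.val + v.2.val - u.1.val = u.2.val by omega]

theorem sub_mul_monRow₂_vecMul_insideMat (a b : ℂ) {v : Fin n × Fin n} (hv : v.1 < v.2) :
    (a - b) * (monRow₂ n a b ᵥ* insideMat n) v = b * monRow₂ n b a v - a * monRow₂ n a b v := by
  obtain ⟨k, hk⟩ := Nat.exists_eq_add_of_lt (Fin.lt_def.1 hv)
  have hpow : ∀ i ∈ Finset.Ico (v.1.val + 1) v.2.val, a ^ i * b ^ (v.1.val + v.2.val - i) =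
      a ^ i * b ^ (v.2.val - 1 - i) * b ^ (v.1.val + 1) := fun i hi => by
    rw [Finset.mem_Ico] at hi
    rw [mul_assoc, ← pow_add]
    congr 2
    omega
  simp only [vecMul, dotProduct, insideMat_apply, monRow₂]
  rw [sum_mul_iverson_inside fun x y => a ^ x * b ^ y, Finset.sum_congr rfl hpow,
    ← Finset.sum_mul, ← mul_assoc, mul_geom_sum₂_Ico a b (Fin.lt_def.1 hv), hk,
    Nat.succ_eq_add_one, show v.1.val + k + 1 - (v.1.val + 1) = k by omega]
  ring

theorem vecMul_insideMat_of_not_lt (x : Fin n × Fin n → ℂ) {v : Fin n × Fin n} (hv : ¬v.1 < v.2) :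
    (x ᵥ* insideMat n) v = 0 :=
  Finset.sum_eq_zero fun _ _ => mul_eq_zero_of_right _ (iverson_false fun h => hv h.lt)

theorem vecMul_swapMat (x : Fin n × Fin n → ℂ) : x ᵥ* swapMat n = x ∘ Prod.swap := by
  ext v
  simp only [swapMat_eq_submatrix_id_swap, vecMul, dotProduct, submatrix_apply, id_eq, one_apply,
    mul_ite, mul_one, mul_zero, Finset.sum_ite_eq', Finset.mem_univ, if_true, Function.comp_apply]

theorem monRow₂_vecMul_cgR_apply (q a b : ℂ) (v : Fin n × Fin n) :
    (monRow₂ n a b ᵥ* cgR n q) v = byOrder q q q⁻¹ v * monRow₂ n a b v +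
      (q - q⁻¹) * (byOrder 1 0 0 v * monRow₂ n b a v + ((monRow₂ n a b ᵥ* insideMat n) v -
        (monRow₂ n a b ᵥ* insideMat n) v.swap)) := by
  have hflip : monRow₂ n a b ᵥ* swapMat n = monRow₂ n b a := by
    rw [vecMul_swapMat]
    exact funext fun u => mul_comm _ _
  rw [cgR, insideComb_eq, one_smul, one_smul, ← swapMat_mul_orderDiag, vecMul_add, vecMul_smul,
    vecMul_add, vecMul_sub, ← vecMul_vecMul, ← vecMul_vecMul, hflip, vecMul_swapMat]
  simp only [orderDiag, vecMul_diagonal, Pi.add_apply, Pi.sub_apply, Pi.smul_apply, smul_eq_mul,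
    Function.comp_apply, mul_comm (byOrder _ _ _ v)]

theorem isExchange_cgR (n : ℕ) (q : ℂ) : IsExchange (cgR n q) q (q - q⁻¹) := by
  intro a b hab
  have hab' := sub_ne_zero.2 hab
  ext v
  rw [monRow₂_vecMul_cgR_apply]
  simp only [Pi.add_apply, Pi.smul_apply, smul_eq_mul, exchCoeff]
  rcases lt_trichotomy v.1 v.2 with h | h | h
  · have hsum := sub_mul_monRow₂_vecMul_insideMat a b h
    rw [byOrder_of_lt h, byOrder_of_lt h, vecMul_insideMat_of_not_lt (v := v.swap) _ h.not_gt,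
      eq_div_of_mul_eq hab' ((mul_comm _ _).trans hsum)]
    generalize q - q⁻¹ = l
    field_simp
    ring
  · have hswap : monRow₂ n b a v = monRow₂ n a b v := by
      rw [monRow₂, monRow₂, h, mul_comm]
    rw [byOrder_of_eq h, byOrder_of_eq h, vecMul_insideMat_of_not_lt _ h.not_lt,
      vecMul_insideMat_of_not_lt (v := v.swap) _ h.not_gt, hswap]
    ring
  · have hsum := sub_mul_monRow₂_vecMul_insideMat a b (v := v.swap) h
    have hswap : ∀ x y, monRow₂ n x y v.swap = monRow₂ n y x v := fun x y => mul_comm _ _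
    rw [hswap, hswap] at hsum
    rw [byOrder_of_gt h, byOrder_of_gt h, vecMul_insideMat_of_not_lt _ h.not_gt,
      eq_div_of_mul_eq hab' ((mul_comm _ _).trans hsum)]
    generalize q⁻¹ = p
    field_simp
    ring

theorem qybe_cgR (n : ℕ) (q : ℂ) : QYBE (cgR n q) := (isExchange_cgR n q).qybe

theorem val_add_val_eq_of_cgR_apply_ne_zero {q : ℂ} {u v : Fin n × Fin n} (h : cgR n q u v ≠ 0) :
    u.1.val + u.2.val = v.1.val + v.2.val := by
  contrapose! h
  have huv : u ≠ v := fun huv => h (by rw [huv])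
  have huv' : u ≠ v.swap := fun huv' => h (by rw [huv', add_comm]; rfl)
  have hin : ¬Inside u v := fun hin => h hin.1
  have hin' : ¬Inside u v.swap := fun hin' => h (hin'.1.trans (add_comm _ _))
  simp only [cgR, Matrix.add_apply, Matrix.smul_apply, orderDiag_apply,
    orderDiag_mul_swapMat_apply, insideComb_apply, if_neg huv, if_neg huv', iverson_false hin,
    iverson_false hin', mul_zero, sub_zero, add_zero, smul_zero]

end Exchange

section RZero

variable {n : ℕ}

theorem simpleRoot_vecMul_apply (k : Fin (n - 1)) (s : Matrix (Fin n) (Fin n) ℂ) (j : Fin n) :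
    (simpleRoot k ᵥ* s) j = s (simplePair k).1 j - s (simplePair k).2 j := by
  rw [simpleRoot, rootVec, sub_vecMul, single_one_vecMul, single_one_vecMul]
  rfl

theorem BDTriple.cremmerGervais_isR0_iff {s : Matrix (Fin n) (Fin n) ℂ} :
    (cremmerGervais n).IsR0 s ↔ sᵀ = -s ∧ ∀ (k : Fin (n - 1)) (hk : k.val + 1 < n - 1),
      (simpleRoot k - simpleRoot ⟨k.val + 1, hk⟩) ᵥ* s =
        (1 / 2 : ℂ) • (simpleRoot k + simpleRoot ⟨k.val + 1, hk⟩) :=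
  and_congr_right fun _ =>
    ⟨fun h k hk => h ⟨k, Finset.mem_filter.2 ⟨Finset.mem_univ _, hk⟩⟩,
      fun h k => h k.1 (Finset.mem_filter.1 k.2).2⟩

/-- The coefficient matrix `½ sgn(j - i)` of a particular solution `r⁰` of the equations of the
Cremmer-Gervais triple. -/
def halfSign (n : ℕ) : Matrix (Fin n) (Fin n) ℂ := of fun i j => byOrder (1 / 2) 0 (-1 / 2) (i, j)

theorem simpleRoot_vecMul_halfSign (k : Fin (n - 1)) :
    simpleRoot k ᵥ* halfSign n =
      (1 / 2 : ℂ) • (Pi.single (simplePair k).1 1 + Pi.single (simplePair k).2 1) := by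
  ext j
  rw [simpleRoot_vecMul_apply]
  simp only [halfSign, of_apply, byOrder, simplePair, Pi.smul_apply, Pi.add_apply, Pi.single_apply,
    Fin.lt_def, Fin.ext_iff, smul_eq_mul]
  split_ifs <;> first | omega | norm_num

theorem transpose_halfSign : (halfSign n)ᵀ = -halfSign n := by
  ext i j
  refine (byOrder_swap (1 / 2) 0 (-1 / 2) (i, j)).trans ?_
  rw [Matrix.neg_apply, halfSign, of_apply, map_byOrder (-·), neg_zero, neg_div, neg_neg]

theorem BDTriple.cremmerGervais_isR0_halfSign : (cremmerGervais n).IsR0 (halfSign n) := by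
  refine cremmerGervais_isR0_iff.2 ⟨transpose_halfSign, fun k hk => ?_⟩
  rw [sub_vecMul, simpleRoot_vecMul_halfSign, simpleRoot_vecMul_halfSign, ← smul_sub, simpleRoot,
    simpleRoot, rootVec, rootVec, simplePair, simplePair]
  congr 1
  abel

theorem exists_forall_eq_of_succ_eq {m : ℕ} {E : Type*} [Nonempty E] {f : Fin m → E}
    (h : ∀ (k : Fin m) (hk : k.val + 1 < m), f ⟨k.val + 1, hk⟩ = f k) : ∃ c, ∀ k, f k = c := by
  cases m with
  | zero => exact ⟨Classical.arbitrary E, fun k => k.elim0⟩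
  | succ m =>
    refine ⟨f 0, fun k => ?_⟩
    induction k using Fin.induction with
    | zero => rfl
    | succ k ih => exact (h k.castSucc (Nat.succ_lt_succ k.isLt)).trans ih

theorem exists_forall_eq_mul_sub {f : Matrix (Fin n) (Fin n) ℂ} (hanti : fᵀ = -f)
    (hroot : ∀ (k : Fin (n - 1)) (hk : k.val + 1 < n - 1),
      simpleRoot ⟨k.val + 1, hk⟩ ᵥ* f = simpleRoot k ᵥ* f) :
    ∃ t : ℂ, ∀ i j : Fin n, f i j = t * ((j.val : ℂ) - i.val) := by
  have hswap : ∀ i j, f j i = -f i j := fun i j => congrFun (congrFun hanti i) j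
  obtain ⟨w, hw⟩ := exists_forall_eq_of_succ_eq (f := fun k => simpleRoot k ᵥ* f) hroot
  obtain ⟨c, hc⟩ := exists_forall_eq_of_succ_eq (f := fun i : Fin n => f i + (i.val : ℂ) • w)
    fun k hk => by
      ext j
      have hkj : f k j - f ⟨k.val + 1, hk⟩ j = w j :=
        (simpleRoot_vecMul_apply ⟨k.val, by omega⟩ f j).symm.trans (congrFun (hw _) j)
      simp only [Pi.add_apply, Pi.smul_apply, smul_eq_mul, Nat.cast_add, Nat.cast_one]
      linear_combination -hkj
  have hf : ∀ i j, f i j = w j * ((j.val : ℂ) - i.val) := fun i j => by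
    have hi : f i j + i.val * w j = c j := congrFun (hc i) j
    have hj : f j j + j.val * w j = c j := congrFun (hc j) j
    linear_combination hi - hj + self_eq_neg.1 (hswap j j)
  obtain ⟨t, ht⟩ := exists_forall_eq_of_succ_eq (f := w) fun k hk => by
    have hk' := hswap ⟨k.val + 1, hk⟩ k
    rw [hf, hf] at hk'
    push_cast at hk'
    linear_combination hk'
  exact ⟨t, fun i j => by rw [hf, ht]⟩

theorem BDTriple.IsR0.exists_forall_eq_halfSign_add
    {s : Matrix (Fin n) (Fin n) ℂ} (hs : (cremmerGervais n).IsR0 s) :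
    ∃ t : ℂ, ∀ i j : Fin n, s i j = halfSign n i j + t * ((j.val : ℂ) - i.val) := by
  obtain ⟨hanti, hroot⟩ := cremmerGervais_isR0_iff.1 hs
  obtain ⟨hanti', hroot'⟩ := cremmerGervais_isR0_iff.1 (cremmerGervais_isR0_halfSign (n := n))
  obtain ⟨t, ht⟩ := exists_forall_eq_mul_sub (f := s - halfSign n)
    (by rw [transpose_sub, hanti, hanti']; abel) fun k hk => by
      rw [← sub_eq_zero, ← neg_eq_zero, neg_sub, ← sub_vecMul, vecMul_sub, hroot, hroot', sub_self]
  exact ⟨t, fun i j => by rw [← ht, Matrix.sub_apply, add_sub_cancel]⟩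

end RZero

namespace BDTriple

variable {n : ℕ}

theorem commutesWithDiagonal_cgR (q p : ℂ) :
    CommutesWithDiagonal (fun i : Fin n => p ^ i.val) (cgR n q) := fun u v huv => by
  rw [← pow_add, ← pow_add, val_add_val_eq_of_cgR_apply_ne_zero huv]

theorem qpowRZero_eq {s : Matrix (Fin n) (Fin n) ℂ} {t : ℂ}
    (ht : ∀ i j : Fin n, s i j = halfSign n i j + t * ((j.val : ℂ) - i.val)) (ħ : ℂ) :
    qpowRZero s ħ = (diagonal fun u : Fin n × Fin n => qpow ħ t ^ u.2.val / qpow ħ t ^ u.1.val) *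
      orderDiag n (qpow ħ (1 / 2)) 1 (qpow ħ (1 / 2))⁻¹ := by
  have hpow : ∀ k : ℕ, qpow ħ t ^ k = qpow ħ (t * k) := fun k => by
    rw [qpow, qpow, ← Complex.exp_nat_mul]
    congr 1
    ring
  rw [qpowRZero, orderDiag, diagonal_mul_diagonal]
  congr 1
  ext u
  have hsub : qpow ħ (t * (u.2.val - u.1.val)) = qpow ħ t ^ u.2.val / qpow ħ t ^ u.1.val := by
    rw [hpow, hpow, mul_sub, sub_eq_add_neg, qpow_add, qpow_neg, div_eq_mul_inv]
  rw [ht, add_comm, qpow_add, hsub, halfSign, of_apply, map_byOrder (qpow ħ), qpow_zero, neg_div,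
    qpow_neg]

theorem cremmerGervais_qybe {s : Matrix (Fin n) (Fin n) ℂ} (hs : (cremmerGervais n).IsR0 s)
    (ħ : ℂ) : QYBE ((cremmerGervais n).RGGS s ħ) := by
  obtain ⟨t, ht⟩ := hs.exists_forall_eq_halfSign_add
  let d : Fin n → ℂ := fun i => qpow ħ t ^ i.val
  have hd : ∀ i, d i ≠ 0 := fun i => pow_ne_zero _ (qpow_ne_zero ħ t)
  have hcomm : CommutesWithDiagonal d (cgR n (qpow ħ (1 / 2) ^ 2)) :=
    commutesWithDiagonal_cgR _ _
  have htwist : (cremmerGervais n).RGGS s ħ = twist (d ^ 2) (cgR n (qpow ħ (1 / 2) ^ 2)) := by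
    let D : Mat2 n := diagonal fun u => d u.2 / d u.1
    let O : Mat2 n := orderDiag n (qpow ħ (1 / 2)) 1 (qpow ħ (1 / 2))⁻¹
    have hDO : D * O = O * D := (commute_diagonal _ _).eq
    calc
      _ = D * O * cgCore n (qpow ħ (1 / 2)) * (O * D) := by
        rw [← hDO, cremmerGervais_RGGS, qpowRZero_eq ht]
      _ = D * (O * cgCore n (qpow ħ (1 / 2)) * O) * D := by simp only [mul_assoc]
      _ = _ := by
        rw [orderDiag_mul_cgCore_mul_orderDiag (qpow_ne_zero ħ _),
          hcomm.diagonal_mul_mul_diagonal hd]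
  rw [htwist]
  exact (qybe_cgR n _).twist hcomm.sq fun i => pow_ne_zero 2 (hd i)

end BDTriple

end GGS

end

theorem mainTheorem2 (n : ℕ) (T : GGS.BDTriple n)
    (hT : T = GGS.BDTriple.cremmerGervais n ∨ T = (GGS.BDTriple.cremmerGervais n).inverse)
    (s : Matrix (Fin n) (Fin n) ℂ) (hs : T.IsR0 s) :
    (∀ R : ℂ → GGS.Mat2 n, T.IsGGS s R ↔ R = T.RGGS s) ∧
      (∀ ħ : ℂ, T.RJ s ħ = T.RGGS s ħ) ∧
      (∀ ħ : ℂ, GGS.QYBE (T.RJ s ħ)) := by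
  rcases hT with rfl | rfl
  · have hGGS := GGS.BDTriple.isGGS_RGGS (s := s) GGS.BDTriple.cremmerGervais_aMat_sq_mul_epsMat
    have hRJ := GGS.BDTriple.cremmerGervais_RJ s
    refine ⟨fun R => ⟨fun h => h.eq hGGS, fun h => h ▸ hGGS⟩, hRJ, fun ħ => ?_⟩
    rw [hRJ]
    exact GGS.BDTriple.cremmerGervais_qybe hs ħ
  · have hGGS := GGS.BDTriple.isGGS_RGGS (s := s)
      GGS.BDTriple.inverse_cremmerGervais_aMat_sq_mul_epsMat
    have hRJ := GGS.BDTriple.inverse_cremmerGervais_RJ s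
    refine ⟨fun R => ⟨fun h => h.eq hGGS, fun h => h ▸ hGGS⟩, hRJ, fun ħ => ?_⟩
    rw [hRJ, GGS.BDTriple.inverse_cremmerGervais_RGGS]
    exact (GGS.BDTriple.cremmerGervais_qybe hs.transpose_of_inverse ħ).antiflip
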